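/- **Proposition (recognition of Horn/2CNF backdoors).** A CNF formula is a finite set of clauses; a clause is a finite set of literals that does not contain both $v$ and $\neg v$ for any variable $v$. For a partial truth assignment $\tau$, $F[\tau]$ is the formula obtained from $F$ by removing all clauses satisfied by $\tau$ and removing the literals falsified by $\tau$ from the remaining clauses. For a class $\mathcal{C}$ of CNF formulas, a (strong) $\mathcal{C}$-backdoor of $F$ is a finite set $B$ of variables such that $F[\tau]\in\mathcal{C}$ for every truth assignment $\tau$ to the variables in $B$. Let $\mathrm{Horn}$ be the class of formulas in which every clause has at most one positive literal, and $2\mathrm{CNF}$ the class of formulas in which every clause has at most two literals. For $\mathcal{C}\in\{\mathrm{Horn},2\mathrm{CNF}\}$ consider the parameterized problem: given a CNF formula $F$ and an integer $k\ge 0$ (the parameter), does $F$ have a $\mathcal{C}$-backdoor of size at most $k$? (Formulas are given as words over a finite alphabet, with variables named by binary words.) Both problems admit polynomial kernels, with a linear and a quadratic number of variables, respectively. That is, for each of the two problems there are a polynomial $g$, a constant $c$ and an algorithm that maps every instance $(x,k)$, in time polynomial in $|x|+k$, to an instance $(x',k')$ of the same problem such that 1. $(x,k)$ is a yes-instance if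 and only if $(x',k')$ is a yes-instance; 2. $|x'|+k'\le g(k)$; 3. $x'$ represents a CNF formula with at most $c\,(k+1)$ variables in the case of $\mathrm{Horn}$, and at most $c\,(k+1)^2$ variables in the case of $2\mathrm{CNF}$. -/

import Mathlib

namespace BackdoorKernel

/-! ### A machine model with a step count

The model is the WHILE language over binary trees (as in textbooks on complexity theory that
start from programming languages), in variable-free form: the memory is one binary tree, and a
program maps the tree it receives to the tree it leaves. Every elementary operation is charged the
size of the whole tree it works on (never unit cost for large data), so the output of a run is
never larger than the cost of the run, and costs are polynomially related to the step counts of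
multitape Turing machines. -/

/-- Binary trees. -/
inductive Data : Type
  | nil : Data
  | node : Data → Data → Data
  deriving DecidableEq

namespace Data

/-- Number of nodes and leaves. -/
def size : Data → ℕ
  | nil => 1
  | node a b => a.size + b.size + 1

/-- Left subtree. -/
def head : Data → Data
  | nil => nil
  | node a _ => a

/-- Right subtree. -/
def tail : Data → Data
  | nil => nil
  | node _ b => b

/-- A list of trees as a tree. -/
def ofList : List Data → Data
  | [] => nil
  | a :: l => node a (ofList l)

end Data

/-- Programs. A program maps a tree to a tree, or does not halt. -/
inductive Prog : Type
  /-- leave the tree unchanged -/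
  | skip : Prog
  /-- return the empty tree -/
  | nil : Prog
  /-- return the left subtree -/
  | head : Prog
  /-- return the right subtree -/
  | tail : Prog
  /-- return a nonempty tree if the left and the right subtree are equal, otherwise `nil` -/
  | eq : Prog
  /-- run two programs on copies of the tree and join the results -/
  | pair : Prog → Prog → Prog
  /-- run the first program, then the second -/
  | seq : Prog → Prog → Prog
  /-- `cond c p q`: if the result of `c` is nonempty then `p`, else `q` -/
  | cond : Prog → Prog → Prog → Prog
  /-- `loop c p`: while the result of `c` is nonempty do `p` -/
  | loop : Prog → Prog → Prog

/-- `Runs p x y t`: on input `x`, the program `p` halts with output `y` after a run of cost `t`. -/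
inductive Runs : Prog → Data → Data → ℕ → Prop
  | skip (x : Data) : Runs .skip x x (x.size + 1)
  | nil (x : Data) : Runs .nil x .nil (x.size + 1)
  | head (x : Data) : Runs .head x x.head (x.size + 1)
  | tail (x : Data) : Runs .tail x x.tail (x.size + 1)
  | eq (x : Data) :
      Runs .eq x (if x.head = x.tail then .node .nil .nil else .nil) (x.size + 2)
  | pair {p q : Prog} {x y z : Data} {s t : ℕ} :
      Runs p x y s → Runs q x z t → Runs (.pair p q) x (.node y z) (s + t + x.size + 1)
  | seq {p q : Prog} {x y z : Data} {s t : ℕ} :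
      Runs p x y s → Runs q y z t → Runs (.seq p q) x z (s + t + 1)
  | cond_true {c p q : Prog} {x b y : Data} {s t : ℕ} :
      Runs c x b s → b ≠ .nil → Runs p x y t → Runs (.cond c p q) x y (s + t + x.size + 1)
  | cond_false {c p q : Prog} {x y : Data} {s t : ℕ} :
      Runs c x .nil s → Runs q x y t → Runs (.cond c p q) x y (s + t + x.size + 1)
  | loop_stop {c p : Prog} {x : Data} {s : ℕ} :
      Runs c x .nil s → Runs (.loop c p) x x (s + x.size + 1)
  | loop_step {c p : Prog} {x b y z : Data} {s t u : ℕ} :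
      Runs c x b s → b ≠ .nil → Runs p x y t → Runs (.loop c p) y z u →
        Runs (.loop c p) x z (s + t + u + x.size + 1)

/-! ### Parameterized problems and kernelizations -/

/-- The finite alphabet: two digits, the two signs of literals, and an end-of-clause mark. -/
inductive Sym : Type
  | zero | one | pos | neg | endClause
  deriving DecidableEq

/-- The constant-size trees that stand for the symbols. -/
def Sym.toData : Sym → Data
  | .zero => .nil
  | .one => .node .nil .nil
  | .pos => .node .nil (.node .nil .nil)
  | .neg => .node (.node .nil .nil) .nil
  | .endClause => .node (.node .nil .nil) (.node .nil .nil)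

/-- The pair of a word `x` and a parameter `k` (in unary) as a tree. -/
def instToData (I : List Sym × ℕ) : Data :=
  .node (.ofList (I.1.map Sym.toData)) (.ofList (List.replicate I.2 .nil))

/-- A parameterized problem: a set of pairs of a word and a parameter. -/
abbrev ParamProblem : Type := Set (List Sym × ℕ)

/-- `K` is computed by one program in time polynomial in `|x| + k`. -/
def PolyTimeComputable (K : List Sym × ℕ → List Sym × ℕ) : Prop :=
  ∃ (p : Prog) (T : Polynomial ℕ), ∀ (x : List Sym) (k : ℕ),
    ∃ t ≤ T.eval (x.length + k), Runs p (instToData (x, k)) (instToData (K (x, k))) t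

/-- `K` is a kernelization of polynomial size for the problem `P`. -/
def IsPolyKernelization (P : ParamProblem) (K : List Sym × ℕ → List Sym × ℕ) : Prop :=
  PolyTimeComputable K ∧
  (∀ I : List Sym × ℕ, I ∈ P ↔ K I ∈ P) ∧
  ∃ g : Polynomial ℕ, ∀ (x : List Sym) (k : ℕ),
    (K (x, k)).1.length + (K (x, k)).2 ≤ g.eval k

/-! ### CNF formulas and backdoors -/

/-- Variables are named by binary words. -/
abbrev Var : Type := List Bool

/-- `(v, true)` is the positive literal `v`, and `(v, false)` is the negative literal `¬v`. -/
abbrev Literal : Type := Var × Bool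

/-- A clause is a finite set of literals. -/
abbrev Clause : Type := Finset Literal

/-- A CNF formula is a finite set of clauses. -/
abbrev Formula : Type := Finset Clause

/-- No clause contains a complementary pair of literals. -/
def NonTautological (F : Formula) : Prop :=
  ∀ C ∈ F, ∀ v : Var, ¬ ((v, true) ∈ C ∧ (v, false) ∈ C)

/-- The set of variables that occur in a formula. -/
def vars (F : Formula) : Finset Var :=
  F.biUnion fun C => C.image Prod.fst

/-- A partial truth assignment; `none` means unassigned. -/
abbrev PartialAssignment : Type := Var → Option Bool

/-- `F[τ]`: satisfied clauses are removed, and false literals are removed from the rest. -/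
def applyAssignment (F : Formula) (τ : PartialAssignment) : Formula :=
  (F.filter fun C => ¬ ∃ l ∈ C, τ l.1 = some l.2).image
    fun C => C.filter fun l => τ l.1 ≠ some (!l.2)

/-- `B` is a strong `𝒞`-backdoor set of `F`: for every truth assignment `τ` to the variables
in `B`, the formula `F[τ]` belongs to `𝒞`. -/
def IsBackdoor (𝒞 : Set Formula) (F : Formula) (B : Finset Var) : Prop :=
  ∀ τ : PartialAssignment, (∀ v, (τ v).isSome ↔ v ∈ B) → applyAssignment F τ ∈ 𝒞

/-- Horn formulas: each clause has at most one positive literal. -/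
def Horn : Set Formula :=
  {F | ∀ C ∈ F, (C.filter fun l => l.2 = true).card ≤ 1}

/-- `r`CNF formulas: each clause has at most `r` literals. -/
def CNF (r : ℕ) : Set Formula :=
  {F | ∀ C ∈ F, C.card ≤ r}

/-- A literal as a word: its sign, then the name of its variable. -/
def encodeLiteral (l : Literal) : List Sym :=
  (if l.2 then Sym.pos else Sym.neg) :: l.1.map fun b => if b then Sym.one else Sym.zero

/-- A list of literals as a word: the literals one after the other, then the end mark. -/
def encodeClause (C : List Literal) : List Sym :=
  C.flatMap encodeLiteral ++ [Sym.endClause]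

/-- The word `x` represents the formula `F`: it lists the clauses of `F`, each one as a list of
its literals, and `F` is a CNF formula (no clause contains complementary literals). -/
def Encodes (x : List Sym) (F : Formula) : Prop :=
  NonTautological F ∧ ∃ L : List (List Literal),
    x = L.flatMap encodeClause ∧ F = (L.map List.toFinset).toFinset

/-- Recognition of `𝒞`-backdoors. Instance: a CNF formula `F` and an integer `k`, which is the
parameter. Question: does `F` have a `𝒞`-backdoor of size at most `k`? Words that do not represent
a CNF formula are no-instances. -/
def BackdoorRecognition (𝒞 : Set Formula) : ParamProblem :=
  {I | ∃ F : Formula, Encodes I.1 F ∧ ∃ B : Finset Var, B.card ≤ I.2 ∧ IsBackdoor 𝒞 F B}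

/-- The problem has a kernelization of polynomial size all of whose outputs are CNF formulas
with at most `N k` variables, where `k` is the parameter of the input. -/
def HasPolyKernelWithVars (𝒞 : Set Formula) (N : ℕ → ℕ) : Prop :=
  ∃ K : List Sym × ℕ → List Sym × ℕ,
    IsPolyKernelization (BackdoorRecognition 𝒞) K ∧
    ∀ (x : List Sym) (k : ℕ), ∃ F : Formula, Encodes (K (x, k)).1 F ∧ (vars F).card ≤ N k

end BackdoorKernel

namespace BackdoorKernel

/-! ### Polynomial-time functions on encoded types -/

/-! Put r = 1 for Horn and r = 2 for 2CNF, and call a literal selected if it counts towards the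
bound r (positive literals for Horn, all literals for 2CNF). As clauses are not tautological, some
assignment to B falsifies every literal of a given clause on B. So B is a backdoor iff it meets
every set of r + 1 selected variables of a clause (`isBackdoor_formulaOfList_iff`), and the task is
to kernelize hitting set for (r + 1)-uniform hypergraphs. Positive clauses turn hypergraphs back
into formulas.

Choose greedily a packing W of edges that pairwise share fewer than r vertices, adding no edge
through a vertex already in more than k members. If k vertices hit W, then |W| is at most k for r =
1 and k(k + 1) for r = 2 (`length_packing_le`), and a vertex in more than k members belongs to the
hitting set (`mem_of_lt_degree`). By maximality, any other edge lies inside the vertices of W or is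
p ∪ {i} with p an r-subset of a member of W and i outside W.

To bound the outside vertices, the tuples p bid in an auction for the vertices i that complete them
to an edge; the kernel keeps only vertices of W and vertices with a bid. A tuple owns at most one
vertex, so few vertices have a bid, and some price level d is unoccupied. Then every tuple adjacent
to a vertex cheaper than d owns a vertex cheaper than d (`exists_level_auction`). As in crown
reductions, replacing each outside vertex cheaper than d in a hitting set of the kernel by a vertex
of its owner yields a hitting set of all edges (`exists_hits_of_hits_kernelEdges`).

Polynomial time is obtained from closure properties of `PolyTime`, with a size control for folds. -/

theorem eval_mono_right (P : Polynomial ℕ) {m n : ℕ} (h : m ≤ n) : P.eval m ≤ P.eval n := by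
  simp only [Polynomial.eval_eq_sum_range]
  exact Finset.sum_le_sum fun i _ => Nat.mul_le_mul_left _ (Nat.pow_le_pow_left h i)

namespace Data

theorem one_le_size (x : Data) : 1 ≤ x.size := by
  cases x <;> simp [size]

theorem size_head_le (x : Data) : x.head.size ≤ x.size := by
  cases x with
  | nil => exact le_rfl
  | node a b => simp only [head, size]; omega

theorem size_tail_le (x : Data) : x.tail.size ≤ x.size := by
  cases x with
  | nil => exact le_rfl
  | node a b => simp only [tail, size]; omega

end Data

/-- Time bounds double as size bounds, which is what makes `PolyTime` closed under composition. -/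
theorem Runs.size_le {p : Prog} {x y : Data} {t : ℕ} (h : Runs p x y t) : y.size ≤ t := by
  induction h with
  | skip x => omega
  | nil x => simp [Data.size]
  | head x => have := x.size_head_le; omega
  | tail x => have := x.size_tail_le; omega
  | eq x => have := x.one_le_size; split <;> simp only [Data.size] <;> omega
  | pair _ _ h₁ h₂ => simp only [Data.size]; omega
  | seq => omega
  | cond_true => omega
  | cond_false => omega
  | loop_stop => omega
  | loop_step => omega

/-- Representation of the elements of a type by trees. -/
class TreeCode (α : Type) where
  /-- the tree that represents an element -/
  enc : α → Data
  enc_injective : Function.Injective enc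

open TreeCode

/-! ### Codes and their sizes -/

namespace TreeCode

/-- The size of the tree that represents an element. -/
def csize {α : Type} [TreeCode α] (a : α) : ℕ := (enc a).size

theorem one_le_csize {α : Type} [TreeCode α] (a : α) : 1 ≤ csize a := Data.one_le_size _

theorem ofList_injective : Function.Injective Data.ofList := by
  intro l
  induction l with
  | nil => intro m h; cases m <;> simp_all [Data.ofList]
  | cons a l ih =>
    intro m h
    cases m with
    | nil => simp [Data.ofList] at h
    | cons b m =>
      simp only [Data.ofList, Data.node.injEq] at h
      rw [h.1, ih h.2]

instance : TreeCode Unit where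
  enc _ := .nil
  enc_injective := fun _ _ _ => rfl

instance : TreeCode Bool where
  enc b := if b then .node .nil .nil else .nil
  enc_injective := by decide

instance : TreeCode Sym where
  enc := Sym.toData
  enc_injective := by intro a b; cases a <;> cases b <;> simp [Sym.toData]

instance {α β : Type} [TreeCode α] [TreeCode β] : TreeCode (α × β) where
  enc x := .node (enc x.1) (enc x.2)
  enc_injective := by
    rintro ⟨a, b⟩ ⟨c, d⟩ h
    simp only [Data.node.injEq] at h
    rw [enc_injective h.1, enc_injective h.2]

instance {α : Type} [TreeCode α] : TreeCode (List α) where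
  enc l := .ofList (l.map enc)
  enc_injective := ofList_injective.comp (List.map_injective_iff.2 enc_injective)

/-- Unary, as in `instToData`, and with the same trees as lists of units, so that arithmetic reduces
to list operations. -/
instance : TreeCode ℕ where
  enc n := .ofList (List.replicate n .nil)
  enc_injective := ofList_injective.comp (List.replicate_left_injective _)

instance {α : Type} [TreeCode α] : TreeCode (Option α) where
  enc o := .ofList (o.toList.map enc)
  enc_injective := by
    refine ofList_injective.comp ((List.map_injective_iff.2 enc_injective).comp ?_)
    intro a b; cases a <;> cases b <;> simp

variable {α β : Type} [TreeCode α] [TreeCode β]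

theorem csize_prod (a : α) (b : β) : csize (a, b) = csize a + csize b + 1 := rfl

theorem csize_nil : csize ([] : List α) = 1 := rfl

theorem csize_cons (a : α) (l : List α) : csize (a :: l) = csize a + csize l + 1 := rfl

theorem csize_bool_le (b : Bool) : csize b ≤ 3 := by cases b <;> decide

theorem length_lt_csize (l : List α) : l.length < csize l := by
  induction l with
  | nil => simp [csize_nil]
  | cons a l ih => rw [csize_cons, List.length_cons]; omega

theorem csize_le_of_mem {a : α} {l : List α} (h : a ∈ l) : csize a ≤ csize l := by
  induction l with
  | nil => simp at h
  | cons b l ih =>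
    rw [csize_cons]
    rcases List.mem_cons.1 h with rfl | h
    · omega
    · have := ih h; omega

theorem csize_append (l m : List α) : csize (l ++ m) + 1 = csize l + csize m := by
  induction l with
  | nil => rw [List.nil_append, csize_nil]; omega
  | cons b l ih => rw [List.cons_append, csize_cons, csize_cons]; omega

end TreeCode

/-- `f` is computed on codes by one program in polynomial time. -/
def PolyTime {α β : Type} [TreeCode α] [TreeCode β] (f : α → β) : Prop :=
  ∃ (p : Prog) (T : Polynomial ℕ), ∀ a, ∃ t ≤ T.eval (csize a), Runs p (enc a) (enc (f a)) t

/-! ### Closure properties of polynomial-time functions -/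

namespace PolyTime

variable {α β γ δ σ : Type} [TreeCode α] [TreeCode β] [TreeCode γ] [TreeCode δ] [TreeCode σ]

theorem csize_le {f : α → β} (hf : PolyTime f) :
    ∃ Q : Polynomial ℕ, ∀ a, csize (f a) ≤ Q.eval (csize a) := by
  obtain ⟨p, T, h⟩ := hf
  refine ⟨T, fun a => ?_⟩
  obtain ⟨t, ht, hr⟩ := h a
  exact hr.size_le.trans ht

/-- Programs see only codes, so results pass freely between types with equal codes: numbers and
lists of units, options and short lists, pairs and nonempty lists. -/
theorem of_enc_eq {f : α → β} {g : α → γ} (hg : PolyTime g) (h : ∀ a, enc (f a) = enc (g a)) :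
    PolyTime f := by
  obtain ⟨p, T, hp⟩ := hg
  refine ⟨p, T, fun a => ?_⟩
  rw [h]
  exact hp a

theorem of_eq {f g : α → β} (hg : PolyTime g) (h : ∀ a, f a = g a) : PolyTime f := by
  rwa [funext h]

theorem comp {g : β → γ} {f : α → β} (hg : PolyTime g) (hf : PolyTime f) :
    PolyTime fun a => g (f a) := by
  obtain ⟨p, T, hp⟩ := hf
  obtain ⟨q, S, hq⟩ := hg
  refine ⟨.seq p q, T + S.comp T + 1, fun a => ?_⟩
  obtain ⟨s, hs, hr⟩ := hp a
  obtain ⟨t, ht, hr'⟩ := hq (f a)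
  refine ⟨_, ?_, hr.seq hr'⟩
  have := eval_mono_right S (hr.size_le.trans hs)
  simp only [Polynomial.eval_add, Polynomial.eval_comp, Polynomial.eval_one]
  change S.eval (csize (f a)) ≤ _ at this
  omega

theorem pair {f : α → β} {g : α → γ} (hf : PolyTime f) (hg : PolyTime g) :
    PolyTime fun a => (f a, g a) := by
  obtain ⟨p, T, hp⟩ := hf
  obtain ⟨q, S, hq⟩ := hg
  refine ⟨.pair p q, T + S + .X + 1, fun a => ?_⟩
  obtain ⟨s, hs, hr⟩ := hp a
  obtain ⟨t, ht, hr'⟩ := hq a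
  refine ⟨_, ?_, hr.pair hr'⟩
  simp only [Polynomial.eval_add, Polynomial.eval_X, Polynomial.eval_one]
  change s + t + csize a + 1 ≤ _
  omega

theorem id : PolyTime fun a : α => a :=
  ⟨.skip, .X + 1, fun a => ⟨_, by simp [csize], .skip _⟩⟩

theorem fst : PolyTime fun x : α × β => x.1 :=
  ⟨.head, .X + 1, fun a => ⟨_, by simp [csize], .head _⟩⟩

theorem snd : PolyTime fun x : α × β => x.2 :=
  ⟨.tail, .X + 1, fun a => ⟨_, by simp [csize], .tail _⟩⟩

theorem fst' {f : α → β × γ} (hf : PolyTime f) : PolyTime fun a => (f a).1 := fst.comp hf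

theorem snd' {f : α → β × γ} (hf : PolyTime f) : PolyTime fun a => (f a).2 := snd.comp hf

theorem const (b : β) : PolyTime fun _ : α => b := by
  suffices h : ∀ y : Data, ∃ (p : Prog) (T : Polynomial ℕ), ∀ x : Data, ∃ t ≤ T.eval x.size,
      Runs p x y t by
    obtain ⟨p, T, h⟩ := h (enc b)
    exact ⟨p, T, fun a => h (enc a)⟩
  intro y
  induction y with
  | nil => exact ⟨.nil, .X + 1, fun x => ⟨_, by simp, .nil x⟩⟩
  | node y z hy hz =>
    obtain ⟨p, T, hp⟩ := hy
    obtain ⟨q, S, hq⟩ := hz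
    refine ⟨.pair p q, T + S + .X + 1, fun x => ?_⟩
    obtain ⟨s, hs, hr⟩ := hp x
    obtain ⟨t, ht, hr'⟩ := hq x
    refine ⟨_, ?_, hr.pair hr'⟩
    simp only [Polynomial.eval_add, Polynomial.eval_X, Polynomial.eval_one]
    omega

theorem cond {c : α → Bool} {f g : α → β} (hc : PolyTime c) (hf : PolyTime f) (hg : PolyTime g) :
    PolyTime fun a => bif c a then f a else g a := by
  obtain ⟨q, R, hq⟩ := hc
  obtain ⟨p, T, hp⟩ := hf
  obtain ⟨p', S, hp'⟩ := hg
  refine ⟨.cond q p p', R + T + S + .X + 1, fun a => ?_⟩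
  obtain ⟨r, hr, hr'⟩ := hq a
  simp only [Polynomial.eval_add, Polynomial.eval_X, Polynomial.eval_one]
  cases h : c a with
  | true =>
    obtain ⟨s, hs, hs'⟩ := hp a
    rw [h] at hr'
    exact ⟨_, by change r + s + csize a + 1 ≤ _; omega, .cond_true hr' (by simp [enc]) hs'⟩
  | false =>
    obtain ⟨s, hs, hs'⟩ := hp' a
    rw [h] at hr'
    exact ⟨_, by change r + s + csize a + 1 ≤ _; omega, .cond_false hr' hs'⟩

theorem ite {c : α → Prop} [DecidablePred c] {f g : α → β} (hc : PolyTime fun a => decide (c a))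
    (hf : PolyTime f) (hg : PolyTime g) : PolyTime fun a => if c a then f a else g a :=
  (hc.cond hf hg).of_eq fun a => by by_cases h : c a <;> simp [h]

theorem not {c : α → Bool} (hc : PolyTime c) : PolyTime fun a => !c a :=
  (hc.cond (const false) (const true)).of_eq fun a => by cases c a <;> rfl

theorem and {b c : α → Bool} (hb : PolyTime b) (hc : PolyTime c) : PolyTime fun a => b a && c a :=
  (hb.cond hc (const false)).of_eq fun a => by cases b a <;> rfl

theorem or {b c : α → Bool} (hb : PolyTime b) (hc : PolyTime c) : PolyTime fun a => b a || c a :=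
  (hb.cond (const true) hc).of_eq fun a => by cases b a <;> rfl

theorem eq [DecidableEq β] {f g : α → β} (hf : PolyTime f) (hg : PolyTime g) :
    PolyTime fun a => decide (f a = g a) := by
  suffices h : PolyTime fun x : β × β => decide (x.1 = x.2) from h.comp (hf.pair hg)
  refine ⟨.eq, .X + 2, fun x => ⟨csize x + 2, by simp, ?_⟩⟩
  have h := Runs.eq (enc x)
  have : (enc x).head = (enc x).tail ↔ x.1 = x.2 := TreeCode.enc_injective.eq_iff
  simp only [this] at h
  have e : enc (decide (x.1 = x.2)) = if x.1 = x.2 then Data.node .nil .nil else .nil := by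
    simp [enc]
  rw [e]
  exact h

theorem cons {f : α → β} {g : α → List β} (hf : PolyTime f) (hg : PolyTime g) :
    PolyTime fun a => f a :: g a := (hf.pair hg).of_enc_eq fun _ => rfl

/-- Case distinction on a list. -/
theorem listCases {l : γ → List α} {f : γ → β} {g : γ → α → List α → β} (hl : PolyTime l)
    (hf : PolyTime f) (hg : PolyTime fun x : γ × α × List α => g x.1 x.2.1 x.2.2) :
    PolyTime fun c => List.casesOn (motive := fun _ => β) (l c) (f c) (g c) := by
  obtain ⟨q, R, hq⟩ := hl
  obtain ⟨q', R', hq'⟩ := (id (α := γ)).pair ⟨q, R, hq⟩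
  obtain ⟨p, T, hp⟩ := hf
  obtain ⟨p', S, hp'⟩ := hg
  -- A nonempty list is coded as the pair of its head and tail, so the code of `(a, l a)` already is
  -- the code of `(a, b, m)`.
  refine ⟨.cond q (.seq q' p') p, R + T + R' + S.comp R' + .X + 2, fun a => ?_⟩
  obtain ⟨r, hr, hr'⟩ := hq a
  simp only [Polynomial.eval_add, Polynomial.eval_X, Polynomial.eval_comp, Polynomial.eval_ofNat]
  cases h : l a with
  | nil =>
    obtain ⟨s, hs, hs'⟩ := hp a
    rw [h] at hr'
    exact ⟨_, by change r + s + csize a + 1 ≤ _; omega, .cond_false hr' hs'⟩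
  | cons b m =>
    obtain ⟨u, hu, hu'⟩ := hq' a
    simp only [h] at hr' hu'
    obtain ⟨s, hs, hs'⟩ := hp' (a, b, m)
    have := eval_mono_right S (hu'.size_le.trans hu)
    change S.eval (csize (a, b, m)) ≤ _ at this
    refine ⟨_, ?_, .cond_true hr' (by simp [enc, Data.ofList]) (hu'.seq hs')⟩
    change r + (u + s + 1) + csize a + 1 ≤ _
    omega

/-- The loop state holds the context, the accumulator and the remaining list. The loop test returns
that list, whose code is `nil` exactly when it is empty. `M` bounds every intermediate state and
hence the cost of each round. -/
theorem foldl_runs {f : γ → σ → α → σ} {pc pb : Prog} {Tc Tb : Polynomial ℕ} (c : γ)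
    (hc : ∀ x : γ × σ × List α, ∃ t ≤ Tc.eval (csize x), Runs pc (enc x) (enc x.2.2) t)
    (hb : ∀ x : γ × σ × α × List α, ∃ t ≤ Tb.eval (csize x),
      Runs pb (enc x) (enc (x.1, f x.1 x.2.1 x.2.2.1, x.2.2.2)) t) (M : ℕ) (l : List α) :
    ∀ s, (∀ l₁ l₂, l = l₁ ++ l₂ → csize (c, l₁.foldl (f c) s, l₂) ≤ M) →
    ∃ t ≤ (l.length + 1) * (Tc.eval M + Tb.eval M + M + 1),
      Runs (.loop pc pb) (enc (c, s, l)) (enc (c, l.foldl (f c) s, ([] : List α))) t := by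
  induction l with
  | nil =>
    intro s hM
    obtain ⟨t, ht, hr⟩ := hc (c, s, [])
    have h₁ : csize (c, s, ([] : List α)) ≤ M := hM [] [] rfl
    have h₂ := eval_mono_right Tc h₁
    refine ⟨_, ?_, Runs.loop_stop hr⟩
    change t + csize (c, s, ([] : List α)) + 1 ≤ _
    simp only [List.length_nil, zero_add, one_mul]
    omega
  | cons a l ih =>
    intro s hM
    obtain ⟨t, ht, hr⟩ := hc (c, s, a :: l)
    obtain ⟨u, hu, hr'⟩ := hb (c, s, a, l)
    obtain ⟨v, hv, hr''⟩ := ih (f c s a) fun l₁ l₂ h => hM (a :: l₁) l₂ (by rw [h]; rfl)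
    have h₁ : csize (c, s, a :: l) ≤ M := hM [] _ rfl
    have h₂ := eval_mono_right Tc h₁
    have h₃ := eval_mono_right Tb h₁
    change Tb.eval (csize (c, s, a, l)) ≤ _ at h₃
    refine ⟨_, ?_, .loop_step hr (by simp [enc, Data.ofList]) hr' hr''⟩
    change t + u + v + csize (c, s, a :: l) + 1 ≤ _
    rw [List.length_cons, add_mul (l.length + 1), one_mul]
    omega

/-- A polynomial-time step could square the state in every round, so the sizes of all intermediate
states have to be bounded separately. -/
theorem foldl_of_csize_le {f : γ → σ → α → σ}
    (hf : PolyTime fun x : γ × σ × α => f x.1 x.2.1 x.2.2) {s : γ → σ} (hs : PolyTime s)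
    {l : γ → List α} (hl : PolyTime l) {Q : Polynomial ℕ}
    (hQ : ∀ c l₁ l₂, l c = l₁ ++ l₂ → csize (l₁.foldl (f c) (s c)) ≤ Q.eval (csize c)) :
    PolyTime fun c => (l c).foldl (f c) (s c) := by
  obtain ⟨pc, Tc, hc⟩ := (snd (α := σ) (β := List α)).comp (snd (α := γ))
  obtain ⟨pb, Tb, hb⟩ : PolyTime fun x : γ × σ × α × List α =>
      (x.1, f x.1 x.2.1 x.2.2.1, x.2.2.2) :=
    fst.pair ((hf.comp (fst.pair (snd.fst'.pair snd.snd'.fst'))).pair snd.snd'.snd')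
  have hinit : PolyTime fun c : γ => (c, s c, l c) := id.pair (hs.pair hl)
  obtain ⟨R, hR⟩ := hl.csize_le
  obtain ⟨p₀, T₀, h₀⟩ := hinit
  obtain ⟨p₁, T₁, h₁⟩ : PolyTime fun x : γ × σ × List α => x.2.1 := snd.fst'
  let M : Polynomial ℕ := .X + Q + R + 2
  refine ⟨.seq p₀ (.seq (.loop pc pb) p₁),
    T₀ + (R + 1) * (Tc.comp M + Tb.comp M + M + 1) + T₁.comp M + 2, fun c => ?_⟩
  obtain ⟨t₀, ht₀, hr₀⟩ := h₀ c
  have hM : ∀ l₁ l₂, l c = l₁ ++ l₂ →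
      csize (c, l₁.foldl (f c) (s c), l₂) ≤ M.eval (csize c) := by
    intro l₁ l₂ h
    have h₁ := hQ c l₁ l₂ h
    have h₂ := hR c
    have h₃ := csize_append l₁ l₂
    rw [← h] at h₃
    have h₄ := one_le_csize l₁
    simp only [csize_prod, M, Polynomial.eval_add, Polynomial.eval_X, Polynomial.eval_ofNat]
    omega
  obtain ⟨t, ht, hr⟩ := foldl_runs c hc hb (M.eval (csize c)) (l c) (s c) hM
  obtain ⟨u, hu, hr'⟩ := h₁ (c, (l c).foldl (f c) (s c), [])
  refine ⟨_, ?_, hr₀.seq (hr.seq hr')⟩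
  have h₅ := eval_mono_right T₁ (hM (l c) [] (List.append_nil _).symm)
  have h₆ : (l c).length + 1 ≤ R.eval (csize c) + 1 := by
    have := length_lt_csize (l c)
    have := hR c
    omega
  have h₇ := ht.trans (Nat.mul_le_mul_right _ h₆)
  simp only [Polynomial.eval_add, Polynomial.eval_mul, Polynomial.eval_comp,
    Polynomial.eval_one, Polynomial.eval_ofNat]
  omega

/-- A fold is polynomial-time if every step adds a bounded amount to the state. -/
theorem foldl {f : γ → σ → α → σ} (hf : PolyTime fun x : γ × σ × α => f x.1 x.2.1 x.2.2)
    {s : γ → σ} (hs : PolyTime s) {l : γ → List α} (hl : PolyTime l) (Q : Polynomial ℕ)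
    (hQ : ∀ c s a, csize (f c s a) ≤ csize s + Q.eval (csize (c, a))) :
    PolyTime fun c => (l c).foldl (f c) (s c) := by
  obtain ⟨R, hR⟩ := hl.csize_le
  obtain ⟨S, hS⟩ := hs.csize_le
  refine foldl_of_csize_le hf hs hl (Q := S + R * Q.comp (.X + R + 1)) fun c l₁ l₂ h => ?_
  simp only [Polynomial.eval_add, Polynomial.eval_mul, Polynomial.eval_comp, Polynomial.eval_X,
    Polynomial.eval_one]
  have key : ∀ m : List α, (∀ a ∈ m, csize a ≤ csize (l c)) → ∀ s, csize (m.foldl (f c) s) ≤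
      csize s + m.length * Q.eval (csize c + R.eval (csize c) + 1) := by
    intro m
    induction m with
    | nil => intro _ s; simp
    | cons a m ih =>
      intro hm s
      have h₁ := ih (fun b hb => hm b (List.mem_cons_of_mem _ hb)) (f c s a)
      have h₂ := hQ c s a
      have h₃ : csize (c, a) ≤ csize c + R.eval (csize c) + 1 := by
        have := hm a List.mem_cons_self
        have := hR c
        rw [csize_prod]
        omega
      have h₄ := eval_mono_right Q h₃
      rw [List.foldl_cons, List.length_cons, add_mul, one_mul]
      omega
  have h₁ := key l₁ (fun a ha => csize_le_of_mem (by rw [h]; exact List.mem_append_left _ ha)) (s c)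
  have h₂ : l₁.length ≤ R.eval (csize c) := by
    have := length_lt_csize (l c)
    have h₃ := hR c
    have h₄ := congrArg List.length h
    rw [List.length_append] at h₄
    omega
  have h₃ := Nat.mul_le_mul_right (Q.eval (csize c + R.eval (csize c) + 1)) h₂
  have h₄ := hS c
  omega

/-! ### List operations and unary arithmetic -/

theorem reverse {l : γ → List α} (hl : PolyTime l) : PolyTime fun c => (l c).reverse := by
  have h : PolyTime fun c => (l c).foldl (fun s a => a :: s) [] := by
    refine foldl (f := fun _ s a => a :: s) (snd.snd'.cons snd.fst') (const []) hl (.X + 1)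
      fun c s a => ?_
    simp only [csize_cons, csize_prod, Polynomial.eval_add, Polynomial.eval_X, Polynomial.eval_one]
    omega
  exact h.of_eq fun c => by simp

theorem foldr {f : γ → α → σ → σ} (hf : PolyTime fun x : γ × σ × α => f x.1 x.2.2 x.2.1)
    {s : γ → σ} (hs : PolyTime s) {l : γ → List α} (hl : PolyTime l) (Q : Polynomial ℕ)
    (hQ : ∀ c a s, csize (f c a s) ≤ csize s + Q.eval (csize (c, a))) :
    PolyTime fun c => (l c).foldr (f c) (s c) :=
  (foldl (f := fun c s a => f c a s) hf hs hl.reverse Q fun c s a => hQ c a s).of_eq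
    fun c => by simp

theorem append {l m : γ → List α} (hl : PolyTime l) (hm : PolyTime m) :
    PolyTime fun c => l c ++ m c := by
  have h : PolyTime fun c => (l c).foldr (fun a s => a :: s) (m c) := by
    refine foldr (f := fun _ a s => a :: s) (snd.snd'.cons snd.fst') hm hl (.X + 1)
      fun c a s => ?_
    simp only [csize_cons, csize_prod, Polynomial.eval_add, Polynomial.eval_X, Polynomial.eval_one]
    omega
  exact h.of_eq fun c => by simp

theorem flatMap {l : γ → List α} {f : γ → α → List β} (hl : PolyTime l)
    (hf : PolyTime fun x : γ × α => f x.1 x.2) : PolyTime fun c => (l c).flatMap (f c) := by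
  obtain ⟨Q, hQ⟩ := hf.csize_le
  have h : PolyTime fun c => (l c).foldr (fun a s => f c a ++ s) [] := by
    refine foldr (f := fun c a s => f c a ++ s)
      (append (hf.comp (fst.pair snd.snd')) snd.fst') (const []) hl Q fun c a s => ?_
    have h₁ := hQ (c, a)
    have h₂ := csize_append (f c a) s
    simp only at h₁
    omega
  refine h.of_eq fun c => ?_
  induction l c with
  | nil => rfl
  | cons a m ih => rw [List.flatMap_cons, List.foldr_cons, ih]

theorem map {l : γ → List α} {f : γ → α → β} (hl : PolyTime l)
    (hf : PolyTime fun x : γ × α => f x.1 x.2) : PolyTime fun c => (l c).map (f c) :=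
  (flatMap hl (f := fun c a => [f c a]) (hf.cons (const []))).of_eq fun c => by
    rw [List.map_eq_flatMap]

theorem flatten {l : γ → List (List α)} (hl : PolyTime l) : PolyTime fun c => (l c).flatten :=
  (flatMap hl (f := fun _ a => a) snd).of_eq fun c => by simp [List.flatMap_def]

theorem filter {l : γ → List α} {f : γ → α → Bool} (hl : PolyTime l)
    (hf : PolyTime fun x : γ × α => f x.1 x.2) : PolyTime fun c => (l c).filter (f c) := by
  refine (flatMap hl (f := fun c a => bif f c a then [a] else [])
    (hf.cond (snd.cons (const [])) (const []))).of_eq fun c => ?_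
  induction l c with
  | nil => rfl
  | cons a m ih => cases h : f c a <;> simp [h, ih]

theorem isEmpty {l : γ → List α} (hl : PolyTime l) : PolyTime fun c => (l c).isEmpty :=
  (listCases hl (const true) (g := fun _ _ _ => false) (const false)).of_eq fun c => by
    cases l c <;> rfl

theorem any {l : γ → List α} {f : γ → α → Bool} (hl : PolyTime l)
    (hf : PolyTime fun x : γ × α => f x.1 x.2) : PolyTime fun c => (l c).any (f c) :=
  (hl.filter hf).isEmpty.not.of_eq fun c => by
    rw [Bool.eq_iff_iff]; simp

theorem all {l : γ → List α} {f : γ → α → Bool} (hl : PolyTime l)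
    (hf : PolyTime fun x : γ × α => f x.1 x.2) : PolyTime fun c => (l c).all (f c) :=
  (hl.any (f := fun c a => !f c a) hf.not).not.of_eq fun c => by
    rw [Bool.eq_iff_iff]; simp

theorem mem [DecidableEq α] {a : γ → α} {l : γ → List α} {inst : ∀ c, Decidable (a c ∈ l c)}
    (ha : PolyTime a) (hl : PolyTime l) : PolyTime fun c => decide (a c ∈ l c) :=
  (hl.any (f := fun c b => decide (b = a c)) (snd.eq (ha.comp fst))).of_eq fun c => by
    rw [Bool.eq_iff_iff]; simp

theorem head? {l : γ → List α} (hl : PolyTime l) : PolyTime fun c => (l c).head? :=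
  (listCases hl (const none) (g := fun _ a _ => some a)
    ((snd.fst'.cons (const [])).of_enc_eq fun _ => rfl)).of_eq fun c => by cases l c <;> rfl

theorem find? {l : γ → List α} {f : γ → α → Bool} (hl : PolyTime l)
    (hf : PolyTime fun x : γ × α => f x.1 x.2) : PolyTime fun c => (l c).find? (f c) :=
  (hl.filter hf).head?.of_eq fun c => by simp

theorem toList {o : γ → Option α} (ho : PolyTime o) : PolyTime fun c => (o c).toList :=
  ho.of_enc_eq fun _ => rfl

theorem some {a : γ → α} (ha : PolyTime a) : PolyTime fun c => Option.some (a c) :=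
  (ha.cons (const [])).of_enc_eq fun _ => rfl

theorem dedup [DecidableEq α] {l : γ → List α} (hl : PolyTime l) :
    PolyTime fun c => (l c).dedup := by
  have h : PolyTime fun c => (l c).foldr (fun a s => if a ∈ s then s else a :: s) [] := by
    refine foldr (f := fun _ a s => if a ∈ s then s else a :: s)
      (ite (mem snd.snd' snd.fst') snd.fst' (snd.snd'.cons snd.fst')) (const []) hl (.X + 1)
      fun c a s => ?_
    simp only [csize_prod, Polynomial.eval_add, Polynomial.eval_X, Polynomial.eval_one]
    split
    · omega
    · rw [csize_cons]; omega
  refine h.of_eq fun c => ?_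
  induction l c with
  | nil => rfl
  | cons a m ih =>
    rw [List.foldr_cons, ← ih]
    by_cases ha : a ∈ m
    · rw [List.dedup_cons_of_mem ha, if_pos (List.mem_dedup.2 ha)]
    · rw [List.dedup_cons_of_notMem ha, if_neg (mt List.mem_dedup.1 ha)]

theorem length {l : γ → List α} (hl : PolyTime l) : PolyTime fun c => (l c).length :=
  (hl.map (f := fun _ _ => ()) (const ())).of_enc_eq fun c => by
    simp only [enc, List.map_map]
    congr 1
    exact (List.eq_replicate_iff.2 ⟨by simp, by simp⟩).symm

theorem replicate_unit {n : γ → ℕ} (hn : PolyTime n) :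
    PolyTime fun c => List.replicate (n c) () :=
  hn.of_enc_eq fun c => by simp [enc]

theorem add {m n : γ → ℕ} (hm : PolyTime m) (hn : PolyTime n) : PolyTime fun c => m c + n c :=
  (hm.replicate_unit.append hn.replicate_unit).length.of_eq fun c => by simp

theorem mul {m n : γ → ℕ} (hm : PolyTime m) (hn : PolyTime n) : PolyTime fun c => m c * n c :=
  (hm.replicate_unit.flatMap (f := fun c _ => List.replicate (n c) ())
    (hn.replicate_unit.comp fst)).length.of_eq fun c => by simp

theorem tail {l : γ → List α} (hl : PolyTime l) : PolyTime fun c => (l c).tail :=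
  (listCases hl (const []) (g := fun _ _ m => m) snd.snd').of_eq fun c => by cases l c <;> rfl

theorem le {m n : γ → ℕ} (hm : PolyTime m) (hn : PolyTime n) :
    PolyTime fun c => decide (m c ≤ n c) := by
  -- Dropping `n c` entries from a list of `m c` units leaves nothing exactly when `m c ≤ n c`.
  have h : PolyTime fun c =>
      (List.replicate (n c) ()).foldl (fun s _ => s.tail) (List.replicate (m c) ()) := by
    refine foldl (f := fun _ s _ => s.tail) snd.fst'.tail hm.replicate_unit hn.replicate_unit 0
      fun c s a => ?_
    cases s with
    | nil => simp
    | cons b s => simp only [List.tail_cons, csize_cons, Polynomial.eval_zero]; omega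
  refine h.isEmpty.of_eq fun c => ?_
  have : ∀ m n : ℕ, (List.replicate n ()).foldl (fun s _ => s.tail) (List.replicate m ()) =
      List.replicate (m - n) () := by
    intro m n
    induction n generalizing m with
    | zero => simp
    | succ n ih =>
      rw [List.replicate_succ, List.foldl_cons, List.tail_replicate, ih]
      congr 1
      omega
  rw [this, Bool.eq_iff_iff]
  simp [Nat.sub_eq_zero_iff_le]

theorem lt {m n : γ → ℕ} (hm : PolyTime m) (hn : PolyTime n) :
    PolyTime fun c => decide (m c < n c) := (hm.add (const 1)).le hn

end PolyTime

/-! ### Hitting sets -/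

section HittingSets

variable {α : Type} [DecidableEq α]

/-- All lists of `n` distinct elements of a list. -/
def tuples : ℕ → List α → List (List α)
  | 0, _ => [[]]
  | n + 1, V =>
    V.flatMap fun v => ((tuples n V).filter fun t => !decide (v ∈ t)).map fun t => v :: t

theorem mem_tuples {n : ℕ} {V t : List α} :
    t ∈ tuples n V ↔ t.length = n ∧ t.Nodup ∧ ∀ v ∈ t, v ∈ V := by
  induction n generalizing t with
  | zero =>
    simp only [tuples, List.mem_singleton, List.length_eq_zero_iff]
    constructor
    · rintro rfl; simp
    · exact fun h => h.1
  | succ n ih =>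
    simp only [tuples, List.mem_flatMap, List.mem_map, List.mem_filter, ih]
    constructor
    · rintro ⟨v, hv, s, ⟨⟨h₁, h₂, h₃⟩, h₄⟩, rfl⟩
      simp only [Bool.not_eq_true', decide_eq_false_iff_not] at h₄
      refine ⟨by simp [h₁], List.nodup_cons.2 ⟨h₄, h₂⟩, ?_⟩
      intro w hw
      rcases List.mem_cons.1 hw with rfl | hw
      · exact hv
      · exact h₃ w hw
    · rintro ⟨h₁, h₂, h₃⟩
      cases t with
      | nil => simp at h₁
      | cons v s =>
        rw [List.nodup_cons] at h₂
        exact ⟨v, h₃ v List.mem_cons_self, s,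
          ⟨⟨by simpa using h₁, h₂.2, fun w hw => h₃ w (List.mem_cons_of_mem _ hw)⟩,
            by simpa using h₂.1⟩, rfl⟩

theorem length_flatMap_le {β γ : Type} (l : List β) (f : β → List γ) (n : ℕ)
    (h : ∀ b ∈ l, (f b).length ≤ n) : (l.flatMap f).length ≤ l.length * n := by
  induction l with
  | nil => simp
  | cons b l ih =>
    have h₁ := h b List.mem_cons_self
    have h₂ := ih fun c hc => h c (List.mem_cons_of_mem _ hc)
    rw [List.flatMap_cons, List.length_append, List.length_cons, add_mul, one_mul]
    omega

theorem length_tuples_le (n : ℕ) (V : List α) : (tuples n V).length ≤ V.length ^ n := by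
  induction n with
  | zero => simp [tuples]
  | succ n ih =>
    rw [tuples, pow_succ']
    refine length_flatMap_le _ _ _ fun v _ => ?_
    rw [List.length_map]
    exact (List.length_filter_le _ _).trans ih

/-- `B` meets every edge of `E`. -/
def Hits (B : Finset α) (E : List (List α)) : Prop := ∀ e ∈ E, ∃ v ∈ e, v ∈ B

/-- Different edges need different vertices of `B`. Disjointness is required only inside `B`, so
that edges with a common vertex outside `B` are covered. -/
theorem length_le_card_of_pairwise {B : Finset α} {E : List (List α)} (hB : Hits B E)
    (hE : E.Pairwise fun e f => ∀ v ∈ e, v ∈ f → v ∉ B) : E.length ≤ B.card := by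
  induction E generalizing B with
  | nil => simp
  | cons e E ih =>
    rw [List.pairwise_cons] at hE
    obtain ⟨v, hv, hvB⟩ := hB e List.mem_cons_self
    have h : E.length ≤ (B.erase v).card := by
      refine ih (fun f hf => ?_) (hE.2.imp fun h w hw hw' hB =>
        h w hw hw' (Finset.mem_of_mem_erase hB))
      obtain ⟨w, hw, hwB⟩ := hB f (List.mem_cons_of_mem _ hf)
      refine ⟨w, hw, Finset.mem_erase.2 ⟨?_, hwB⟩⟩
      rintro rfl
      exact hE.1 f hf w hv hw hvB
    have := Finset.card_erase_add_one hvB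
    rw [List.length_cons]
    omega

/-- Double counting of incidences between edges and vertices of `B`. -/
theorem length_le_card_mul {B : Finset α} {E : List (List α)} {D : ℕ} (hB : Hits B E)
    (hE : ∀ v ∈ B, (E.filter fun e => decide (v ∈ e)).length ≤ D) : E.length ≤ B.card * D := by
  have h₁ : ∀ e ∈ E, 1 ≤ ∑ v ∈ B, if v ∈ e then 1 else 0 := by
    intro e he
    obtain ⟨v, hv, hvB⟩ := hB e he
    rw [← Finset.sum_filter, Finset.sum_const, smul_eq_mul, mul_one, Finset.one_le_card]
    exact ⟨v, Finset.mem_filter.2 ⟨hvB, hv⟩⟩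
  have h₂ : ∀ E : List (List α), (∀ e ∈ E, 1 ≤ ∑ v ∈ B, if v ∈ e then 1 else 0) →
      E.length ≤ ∑ v ∈ B, (E.filter fun e => decide (v ∈ e)).length := by
    intro E
    induction E with
    | nil => simp
    | cons e E ih =>
      intro h
      have h₃ := ih fun f hf => h f (List.mem_cons_of_mem _ hf)
      have h₄ := h e List.mem_cons_self
      have h₅ : ∑ v ∈ B, ((e :: E).filter fun e => decide (v ∈ e)).length =
          (∑ v ∈ B, if v ∈ e then 1 else 0) +
            ∑ v ∈ B, (E.filter fun e => decide (v ∈ e)).length := by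
        rw [← Finset.sum_add_distrib]
        refine Finset.sum_congr rfl fun v _ => ?_
        by_cases hv : v ∈ e <;> simp [hv, add_comm]
      rw [h₅, List.length_cons]
      omega
  exact (h₂ E h₁).trans (by simpa using Finset.sum_le_card_nsmul B _ D hE)

/-! ### Maximal packings -/

/-- The edge `e` has `r` vertices in common with a member of `W`, or contains a vertex that lies in
more than `k` members of `W`. -/
def blocked (r k : ℕ) (W : List (List α)) (e : List α) : Bool :=
  (W.any fun w => decide (r ≤ (e.filter fun v => decide (v ∈ w)).length)) ||
    e.any fun v => decide (k < (W.filter fun w => decide (v ∈ w)).length)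

/-- A maximal set of edges that is built without adding blocked edges. -/
def packing (r k : ℕ) (E : List (List α)) : List (List α) :=
  E.foldr (fun e W => bif blocked r k W e then W else e :: W) []

theorem blocked_iff {r k : ℕ} {W : List (List α)} {e : List α} : blocked r k W e = true ↔
    (∃ w ∈ W, r ≤ (e.filter fun v => decide (v ∈ w)).length) ∨
      ∃ v ∈ e, k < (W.filter fun w => decide (v ∈ w)).length := by
  simp [blocked]

theorem blocked_cons {r k : ℕ} {W : List (List α)} {e : List α} (w : List α)
    (h : blocked r k W e = true) : blocked r k (w :: W) e = true := by
  rw [blocked_iff] at h ⊢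
  rcases h with ⟨f, hf, h⟩ | ⟨v, hv, h⟩
  · exact .inl ⟨f, List.mem_cons_of_mem _ hf, h⟩
  · refine .inr ⟨v, hv, h.trans_le ?_⟩
    exact ((List.sublist_cons_self w W).filter _).length_le

theorem packing_cons (r k : ℕ) (e : List α) (E : List (List α)) : packing r k (e :: E) =
    bif blocked r k (packing r k E) e then packing r k E else e :: packing r k E := rfl

theorem packing_subset (r k : ℕ) (E : List (List α)) : ∀ e ∈ packing r k E, e ∈ E := by
  induction E with
  | nil => intro e he; exact he
  | cons f E ih =>
    intro e he
    rw [packing_cons] at he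
    cases h : blocked r k (packing r k E) f <;> rw [h] at he
    · rcases List.mem_cons.1 he with rfl | he
      · exact List.mem_cons_self
      · exact List.mem_cons_of_mem _ (ih e he)
    · exact List.mem_cons_of_mem _ (ih e he)

theorem pairwise_packing (r k : ℕ) (E : List (List α)) : (packing r k E).Pairwise
    fun e w => (e.filter fun v => decide (v ∈ w)).length < r := by
  induction E with
  | nil => exact .nil
  | cons f E ih =>
    rw [packing_cons]
    cases h : blocked r k (packing r k E) f
    · rw [Bool.eq_false_iff, Ne, blocked_iff, not_or] at h
      refine List.pairwise_cons.2 ⟨fun w hw => ?_, ih⟩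
      by_contra h'
      exact h.1 ⟨w, hw, not_lt.1 h'⟩
    · exact ih

/-- An edge is added only while its vertices have degree at most `k`. Degree `k + 1` must remain
possible, since it is what forces a vertex into small hitting sets. -/
theorem degree_packing_le (r k : ℕ) (E : List (List α)) (v : α) :
    ((packing r k E).filter fun w => decide (v ∈ w)).length ≤ k + 1 := by
  induction E with
  | nil => simp [packing]
  | cons f E ih =>
    rw [packing_cons]
    cases h : blocked r k (packing r k E) f
    · rw [Bool.eq_false_iff, Ne, blocked_iff, not_or] at h
      by_cases hv : v ∈ f
      · rw [cond_false, List.filter_cons_of_pos (by simpa using hv), List.length_cons]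
        by_contra h'
        exact h.2 ⟨v, hv, by omega⟩
      · rwa [cond_false, List.filter_cons_of_neg (by simpa using hv)]
    · exact ih

/-- Maximality: blocking persists when the packing grows, and an added edge blocks itself because it
has at least `r` vertices. -/
theorem blocked_packing {r k : ℕ} {E : List (List α)} (hE : ∀ e ∈ E, r ≤ e.length) :
    ∀ e ∈ E, blocked r k (packing r k E) e = true := by
  induction E with
  | nil => simp
  | cons f E ih =>
    intro e he
    have ih := ih fun e he => hE e (List.mem_cons_of_mem _ he)
    rw [packing_cons]
    cases h : blocked r k (packing r k E) f
    · rcases List.mem_cons.1 he with rfl | he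
      · rw [cond_false, blocked_iff]
        refine .inl ⟨e, List.mem_cons_self, ?_⟩
        rw [List.filter_eq_self.2 (by simp)]
        exact hE e List.mem_cons_self
      · exact blocked_cons f (ih e he)
    · rcases List.mem_cons.1 he with rfl | he
      · exact h
      · exact ih e he

theorem two_le_length_filter {e w : List α} {u v : α} (h : u ≠ v) (hu : u ∈ e) (hu' : u ∈ w)
    (hv : v ∈ e) (hv' : v ∈ w) : 2 ≤ (e.filter fun v => decide (v ∈ w)).length := by
  rw [← Finset.card_pair h]
  refine (Finset.card_le_card ?_).trans (List.toFinset_card_le _)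
  intro x hx
  simp only [Finset.mem_insert, Finset.mem_singleton] at hx
  rcases hx with rfl | rfl <;> simp [*]

/-- Sunflower argument: since `r ≤ 2`, the members through `v` have no other common vertex, so
without `v` more than `k` vertices would be needed to hit them. -/
theorem mem_of_lt_degree {r k : ℕ} (hr : r ≤ 2) {E : List (List α)} {B : Finset α}
    (hB : Hits B (packing r k E)) (hk : B.card ≤ k) {v : α}
    (hv : k < ((packing r k E).filter fun w => decide (v ∈ w)).length) : v ∈ B := by
  by_contra h
  refine absurd (hv.trans_le (length_le_card_of_pairwise (B := B) ?_ ?_)) (not_lt.2 hk)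
  · exact fun e he => hB e (List.mem_filter.1 he).1
  · refine List.Pairwise.imp_of_mem ?_ ((pairwise_packing r k E).sublist List.filter_sublist)
    intro e w he hw hew u hu hu' huB
    have h₁ := (List.mem_filter.1 he).2
    have h₂ := (List.mem_filter.1 hw).2
    simp only [decide_eq_true_eq] at h₁ h₂
    have := two_le_length_filter (by rintro rfl; exact h huB) hu hu' h₁ h₂
    omega

/-- A vertex lies in at most `(r - 1) * k + 1` members: for `r = 1` they are disjoint, and for `r =
2` this is the degree bound. -/
theorem length_packing_le {r k : ℕ} (hr : r = 1 ∨ r = 2) {E : List (List α)} {B : Finset α}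
    (hB : Hits B (packing r k E)) (hk : B.card ≤ k) :
    (packing r k E).length ≤ k * ((r - 1) * k + 1) := by
  refine (length_le_card_mul hB fun v _ => ?_).trans (Nat.mul_le_mul_right _ hk)
  rcases hr with rfl | rfl
  · have h := (pairwise_packing 1 k E).sublist
      (List.filter_sublist (p := fun w => decide (v ∈ w)))
    have h' : ∀ w ∈ (packing 1 k E).filter fun w => decide (v ∈ w), v ∈ w := fun w hw => by
      simpa using (List.mem_filter.1 hw).2
    match hQ : (packing 1 k E).filter fun w => decide (v ∈ w) with
    | [] => simp
    | [_] => simp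
    | e :: w :: Q =>
      rw [hQ] at h h'
      have h₁ := (List.pairwise_cons.1 h).1 w List.mem_cons_self
      have h₂ := h' e (by simp)
      have h₃ := h' w (by simp)
      have : v ∈ e.filter fun v => decide (v ∈ w) := by simp [h₂, h₃]
      have := List.length_pos_of_mem this
      omega
  · simpa using degree_packing_le 2 k E v

end HittingSets

/-! ### Auctions -/

section Auctions

variable {β ι : Type} [DecidableEq ι]

/-- The price of an item: the number of bids on it. -/
def price (l : List (β × ι)) (i : ι) : ℕ := (l.filter fun b => decide (b.2 = i)).length

theorem price_cons (b : β × ι) (l : List (β × ι)) (i : ι) :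
    price (b :: l) i = price l i + if b.2 = i then 1 else 0 := by
  by_cases h : b.2 = i <;> simp [price, h]

theorem price_pos {l : List (β × ι)} {b : β × ι} (h : b ∈ l) : 0 < price l b.2 :=
  List.length_pos_of_mem (a := b) (by simpa using h)

variable [DecidableEq β]

/-- The agent `p` made the latest bid on `i`. Lists of bids start with the latest one. -/
def owns (l : List (β × ι)) (p : β) (i : ι) : Bool :=
  decide ((l.find? fun b => decide (b.2 = i)) = some (p, i))

/-- A bid of an agent that owns nothing for one of its cheapest items, of price at most `m`. -/
def validBid (adj : β → ι → Bool) (m : ℕ) (I : List ι) (l : List (β × ι)) (b : β × ι) : Bool :=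
  adj b.1 b.2 && (I.all fun j => !owns l b.1 j) && decide (price l b.2 ≤ m) &&
    I.all fun j => !adj b.1 j || decide (price l b.2 ≤ price l j)

/-- Add a valid bid if there is one. -/
def auctionStep (adj : β → ι → Bool) (A : List β) (I : List ι) (l : List (β × ι)) :
    List (β × ι) :=
  ((A.flatMap fun p => I.map fun i => (p, i)).find? (validBid adj A.length I l)).toList ++ l

/-- Add valid bids as long as there are any. -/
def auction (adj : β → ι → Bool) (A : List β) (I : List ι) : List (β × ι) :=
  (List.replicate (I.length * (A.length + 1) + 1) ()).foldr (fun _ l => auctionStep adj A I l) []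

theorem owns_cons {b : β × ι} {l : List (β × ι)} {p : β} {i : ι} :
    owns (b :: l) p i = true ↔ b = (p, i) ∨ b.2 ≠ i ∧ owns l p i = true := by
  by_cases h : b.2 = i
  · simp [owns, h]
  · simp only [owns, List.find?_cons, h, decide_false, decide_eq_true_eq, ne_eq, not_false_eq_true,
      true_and, iff_or_self]
    rintro rfl
    exact absurd rfl h

theorem owns_mem {l : List (β × ι)} {p : β} {i : ι} (h : owns l p i = true) : (p, i) ∈ l :=
  List.mem_of_find?_eq_some (by simpa [owns] using h)

theorem exists_owns {l : List (β × ι)} {i : ι} (h : 0 < price l i) : ∃ p, owns l p i = true := by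
  induction l with
  | nil => simp [price] at h
  | cons b l ih =>
    by_cases hb : b.2 = i
    · exact ⟨b.1, owns_cons.2 (.inl (by rw [← hb]))⟩
    · rw [price_cons, if_neg hb] at h
      obtain ⟨p, hp⟩ := ih h
      exact ⟨p, owns_cons.2 (.inr ⟨hb, hp⟩)⟩

theorem price_pos_of_owns {l : List (β × ι)} {p : β} {i : ι} (h : owns l p i = true) :
    0 < price l i := price_pos (owns_mem h)

theorem validBid_iff {adj : β → ι → Bool} {m : ℕ} {I : List ι} {l : List (β × ι)} {p : β} {i : ι} :
    validBid adj m I l (p, i) = true ↔ adj p i = true ∧ (∀ j ∈ I, owns l p j ≠ true) ∧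
      price l i ≤ m ∧ ∀ j ∈ I, adj p j = true → price l i ≤ price l j := by
  simp only [validBid, Bool.and_eq_true, List.all_eq_true, Bool.not_eq_true', decide_eq_true_eq,
    Bool.or_eq_true, and_assoc, ne_eq, Bool.not_eq_true]
  refine and_congr_right fun _ => and_congr_right fun _ => and_congr_right fun _ =>
    forall₂_congr fun j _ => ?_
  cases adj p j <;> simp

/-- The state of an auction after some valid bids. -/
structure IsAuctionState (adj : β → ι → Bool) (A : List β) (I : List ι) (l : List (β × ι)) :
    Prop where
  mem : ∀ b ∈ l, b.1 ∈ A ∧ b.2 ∈ I ∧ adj b.1 b.2 = true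
  owns_unique : ∀ p i j, owns l p i = true → owns l p j = true → i = j
  price_le : ∀ p i j, owns l p i = true → j ∈ I → adj p j = true → price l i ≤ price l j + 1
  price_le_length : ∀ i, price l i ≤ A.length + 1

variable {adj : β → ι → Bool} {A : List β} {I : List ι} {l : List (β × ι)}

theorem isAuctionState_nil : IsAuctionState adj A I [] where
  mem := by simp
  owns_unique := by simp [owns]
  price_le := by simp [owns]
  price_le_length := by simp [price]

/-- The bidder took a cheapest neighbour, so after the increment it overpays by at most one. For
other owners the price of their item is unchanged while alternatives can only get dearer; a previous
owner of `i` loses it. -/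
theorem IsAuctionState.cons (hl : IsAuctionState adj A I l) {p : β} {i : ι} (hp : p ∈ A)
    (hi : i ∈ I) (hb : validBid adj A.length I l (p, i) = true) :
    IsAuctionState adj A I ((p, i) :: l) := by
  obtain ⟨h₁, h₂, h₃, h₄⟩ := validBid_iff.1 hb
  have hI : ∀ {q j}, owns l q j = true → j ∈ I := fun h => (hl.mem _ (owns_mem h)).2.1
  refine ⟨?_, ?_, ?_, ?_⟩
  · intro b hb
    rcases List.mem_cons.1 hb with rfl | hb
    · exact ⟨hp, hi, h₁⟩
    · exact hl.mem b hb
  · intro q j j' hj hj'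
    rw [owns_cons, Prod.mk.injEq] at hj hj'
    rcases hj with ⟨rfl, rfl⟩ | ⟨-, hj⟩ <;> rcases hj' with ⟨h, rfl⟩ | ⟨-, hj'⟩
    · rfl
    · exact absurd hj' (h₂ _ (hI hj'))
    · rw [← h] at hj
      exact absurd hj (h₂ _ (hI hj))
    · exact hl.owns_unique q j j' hj hj'
  · intro q j j' hj hj' hadj
    rw [price_cons, price_cons]
    rw [owns_cons, Prod.mk.injEq] at hj
    rcases hj with ⟨rfl, rfl⟩ | ⟨hij, hj⟩
    · have := h₄ j' hj' hadj
      rw [if_pos rfl]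
      omega
    · have := hl.price_le q j j' hj hj' hadj
      rw [if_neg hij]
      omega
  · intro j
    rw [price_cons]
    have := hl.price_le_length j
    split_ifs with h
    · simp only at h
      subst h
      omega
    · exact this

theorem IsAuctionState.step (hl : IsAuctionState adj A I l) :
    IsAuctionState adj A I (auctionStep adj A I l) := by
  rw [auctionStep]
  cases h : (A.flatMap fun p => I.map fun i => (p, i)).find? (validBid adj A.length I l) with
  | none => exact hl
  | some b =>
    have h₁ := List.mem_of_find?_eq_some h
    have h₂ := List.find?_some h
    simp only [List.mem_flatMap, List.mem_map] at h₁
    obtain ⟨p, hp, i, hi, rfl⟩ := h₁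
    exact hl.cons hp hi h₂

/-- Each bid raises one price by one, so the number of bids is the sum of the prices. -/
theorem IsAuctionState.length_le (hl : IsAuctionState adj A I l) :
    l.length ≤ I.length * (A.length + 1) := by
  have h : ∀ l : List (β × ι), (∀ b ∈ l, b.2 ∈ I) → l.length = ∑ i ∈ I.toFinset, price l i := by
    intro l
    induction l with
    | nil => simp [price]
    | cons b l ih =>
      intro h
      have hb := h b List.mem_cons_self
      simp_rw [price_cons, Finset.sum_add_distrib, ← ih fun c hc => h c (List.mem_cons_of_mem _ hc)]
      simp [hb]
  rw [h l fun b hb => (hl.mem b hb).2.1]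
  refine (Finset.sum_le_card_nsmul _ _ _ fun i _ => hl.price_le_length i).trans ?_
  rw [smul_eq_mul]
  exact Nat.mul_le_mul_right _ (List.toFinset_card_le I)

theorem isAuctionState_auction : IsAuctionState adj A I (auction adj A I) := by
  rw [auction]
  generalize I.length * (A.length + 1) + 1 = n
  induction n with
  | zero => exact isAuctionState_nil
  | succ n ih => exact ih.step

/-- After `n` rounds either no valid bid is left or every round has added one. The number of rounds
in `auction` exceeds the possible number of bids by one. -/
theorem not_validBid_auction {p : β} {i : ι} (hp : p ∈ A) (hi : i ∈ I) :
    validBid adj A.length I (auction adj A I) (p, i) ≠ true := by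
  have key : ∀ n, ((A.flatMap fun p => I.map fun i => (p, i)).find? (validBid adj A.length I
        ((List.replicate n ()).foldr (fun _ l => auctionStep adj A I l) []))) = none ∨
      ((List.replicate n ()).foldr (fun _ l => auctionStep adj A I l) []).length = n := by
    intro n
    induction n with
    | zero => exact .inr rfl
    | succ n ih =>
      rw [List.replicate_succ, List.foldr_cons]
      generalize (List.replicate n ()).foldr (fun _ l => auctionStep adj A I l) [] = l at *
      cases h : (A.flatMap fun p => I.map fun i => (p, i)).find? (validBid adj A.length I l) with
      | none =>
        left
        simp only [auctionStep, h, Option.toList_none, List.nil_append]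
      | some b =>
        right
        rw [h] at ih
        simp only [reduceCtorEq, false_or] at ih
        simp [auctionStep, h, ih]
  rcases key (I.length * (A.length + 1) + 1) with h | h
  · exact List.find?_eq_none.1 h _ (by simp [hp, hi])
  · have := (isAuctionState_auction (adj := adj) (A := A) (I := I)).length_le
    rw [auction, h] at this
    omega

/-- Pigeonhole: items of every price from 1 to `A.length + 1` would have distinct owners, more than
there are agents. -/
theorem IsAuctionState.exists_level (hl : IsAuctionState adj A I l) :
    ∃ d, 1 ≤ d ∧ d ≤ A.length + 1 ∧ ∀ i, price l i ≠ d := by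
  by_contra! h
  have h' : ∀ d ∈ Finset.Icc 1 (A.length + 1), ∃ p, ∃ i, owns l p i = true ∧ price l i = d := by
    intro d hd
    rw [Finset.mem_Icc] at hd
    obtain ⟨i, hi⟩ := h d hd.1 hd.2
    obtain ⟨p, hp⟩ := exists_owns (l := l) (i := i) (by omega)
    exact ⟨p, i, hp, hi⟩
  obtain ⟨p₀, i₀, -⟩ := h' 1 (by simp)
  have : Nonempty β := ⟨p₀⟩
  have : Nonempty ι := ⟨i₀⟩
  choose! f g hf hg using h'
  have := Finset.card_le_card_of_injOn (s := Finset.Icc 1 (A.length + 1)) (t := A.toFinset) f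
    (fun d hd => by
      simpa using (hl.mem _ (owns_mem (hf d hd))).1) (by
      intro d hd d' hd' h
      have h₁ := hf d hd
      have h₂ := hf d' hd'
      rw [← h] at h₂
      rw [← hg d hd, ← hg d' hd', hl.owns_unique _ _ _ h₁ h₂])
  rw [Nat.card_Icc] at this
  have := List.toFinset_card_le A
  omega

/-- There is a level such that the neighbours of the items below the level own items below the
level. -/
theorem exists_level_auction (adj : β → ι → Bool) (A : List β) (I : List ι) :
    ∃ d, 1 ≤ d ∧ ∀ p ∈ A, ∀ i ∈ I, adj p i = true → price (auction adj A I) i < d →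
      ∃ j, owns (auction adj A I) p j = true ∧ price (auction adj A I) j < d := by
  have hl := isAuctionState_auction (adj := adj) (A := A) (I := I)
  obtain ⟨d, hd, hd', h⟩ := hl.exists_level
  refine ⟨d, hd, fun p hp i hi hadj hlt => ?_⟩
  by_cases hown : ∃ j, owns (auction adj A I) p j = true
  · obtain ⟨j, hj⟩ := hown
    -- The price of `j` is at most one above that of `i`, hence at most `d`, and the price `d` does
    -- not occur.
    have h₁ := hl.price_le p j i hj hi hadj
    have h₂ := h j
    exact ⟨j, hj, by omega⟩
  · push Not at hown
    -- An agent without an item could still bid for its cheapest neighbour, whose price is below `d`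
    -- and so at most `A.length`; but the auction is over.
    obtain ⟨j, hj, hmin⟩ := Finset.exists_min_image (I.toFinset.filter fun j => adj p j = true)
      (price (auction adj A I)) ⟨i, by simp [hi, hadj]⟩
    simp only [Finset.mem_filter, List.mem_toFinset, and_imp] at hj hmin
    have h₁ := not_validBid_auction (adj := adj) hp hj.1
    rw [Ne, validBid_iff] at h₁
    have h₂ := hmin i hi hadj
    refine absurd ⟨hj.2, fun j _ => hown j, ?_, hmin⟩ h₁
    omega

/-- An item with a bid always has an owner, and no agent owns two items. -/
theorem IsAuctionState.card_items_le (hl : IsAuctionState adj A I l) :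
    (l.map Prod.snd).toFinset.card ≤ A.length := by
  have h : ∀ i ∈ (l.map Prod.snd).toFinset, ∃ p, owns l p i = true := by
    intro i hi
    simp only [List.mem_toFinset, List.mem_map] at hi
    obtain ⟨b, hb, rfl⟩ := hi
    exact exists_owns (price_pos hb)
  rcases l.eq_nil_or_concat with rfl | ⟨-, b, -⟩
  · simp
  have : Nonempty β := ⟨b.1⟩
  choose! f hf using h
  refine (Finset.card_le_card_of_injOn (t := A.toFinset) f (fun i hi => ?_) ?_).trans
    (List.toFinset_card_le A)
  · simpa using (hl.mem _ (owns_mem (hf i hi))).1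
  · intro i hi j hj h
    have h₁ := hf i hi
    have h₂ := hf j hj
    rw [← h] at h₂
    exact hl.owns_unique _ _ _ h₁ h₂

end Auctions

/-! ### The kernel for hitting sets -/

section Kernel

variable {α : Type} [DecidableEq α]

/-- The bids of the `r`-tuples of vertices of members of `W` for the vertices outside `W`. -/
def tupleAuction (r : ℕ) (W E : List (List α)) : List (List α × α) :=
  auction (fun p i => decide (i :: p ∈ E)) (W.flatMap (tuples r))
    (E.flatten.filter fun v => !decide (v ∈ W.flatten))

/-- The vertices of the kernel. -/
def kernelVertices (r : ℕ) (W E : List (List α)) : List α :=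
  (W.flatten ++ (tupleAuction r W E).map Prod.snd).dedup

/-- The edges of the kernel. -/
def kernelEdges (r : ℕ) (W E : List (List α)) : List (List α) :=
  (tuples (r + 1) (kernelVertices r W E)).filter fun t => decide (t ∈ E)

theorem length_kernelVertices_le {r : ℕ} {W E : List (List α)} (hW : ∀ w ∈ W, w.length = r + 1) :
    (kernelVertices r W E).length ≤ W.length * (r + 1 + (r + 1) ^ r) := by
  have h₁ : (kernelVertices r W E).length =
      (W.flatten ++ (tupleAuction r W E).map Prod.snd).toFinset.card := rfl
  have h₂ := length_flatMap_le W (fun w => w) (r + 1) fun w hw => (hW w hw).le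
  have h₃ := length_flatMap_le W (tuples r) ((r + 1) ^ r) fun w hw => by
    rw [← hW w hw]
    exact length_tuples_le r w
  have h₄ := List.toFinset_card_le W.flatten
  have h₅ := (isAuctionState_auction (adj := fun p i => decide (i :: p ∈ E))
    (A := W.flatMap (tuples r))
    (I := E.flatten.filter fun v => !decide (v ∈ W.flatten))).card_items_le
  rw [h₁, List.toFinset_append, mul_add]
  refine (Finset.card_union_le _ _).trans (Nat.add_le_add ?_ (h₅.trans h₃))
  simpa [List.flatMap_def] using h₄.trans (by simpa [List.flatMap_def] using h₂)

/-- Vertices of `B` outside `W` with price below `d` are moved into the tuple that owns them. If `i`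
is cheaper than `d`, then `p` owns some `j` cheaper than `d`, and `j :: p` is a kernel edge. It is
hit in `p`, or at `j`, which is moved into `p`; either way `i :: p` is hit. Closure under
permutations allows `i` to be put in front. -/
theorem exists_hits_of_hits_kernelEdges {r k : ℕ} (hr : r = 1 ∨ r = 2) {E : List (List α)}
    (hE : ∀ e ∈ E, e.length = r + 1 ∧ e.Nodup) (hperm : ∀ e ∈ E, ∀ f, f.Perm e → f ∈ E)
    {B : Finset α} (hB : Hits B (kernelEdges r (packing r k E) E)) (hk : B.card ≤ k) :
    ∃ C : Finset α, C.card ≤ k ∧ Hits C E := by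
  set W := packing r k E with hW
  set l := tupleAuction r W E with hl
  set I := E.flatten.filter fun v => !decide (v ∈ W.flatten) with hI
  have hst : IsAuctionState (fun p i => decide (i :: p ∈ E)) (W.flatMap (tuples r)) I l :=
    isAuctionState_auction
  obtain ⟨d, hd, hlevel⟩ := exists_level_auction (fun p i => decide (i :: p ∈ E))
    (W.flatMap (tuples r)) I
  change ∀ p ∈ _, ∀ i ∈ I, _ → price l i < d → ∃ j, owns l p j = true ∧ price l j < d at hlevel
  have hmemI : ∀ v, v ∈ I ↔ (∃ e ∈ E, v ∈ e) ∧ ∀ w ∈ W, v ∉ w := by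
    intro v
    rw [hI, List.mem_filter, List.mem_flatten]
    simp
  have hS : ∀ v, v ∈ kernelVertices r W E ↔ (∃ w ∈ W, v ∈ w) ∨ 0 < price l v := by
    intro v
    simp only [kernelVertices, List.mem_dedup, List.mem_append, List.mem_flatten, List.mem_map]
    refine or_congr Iff.rfl ⟨?_, fun h => ?_⟩
    · rintro ⟨b, hb, rfl⟩
      exact price_pos hb
    · obtain ⟨p, hp⟩ := exists_owns h
      exact ⟨_, owns_mem hp, rfl⟩
  have hBe : ∀ e ∈ E, (∀ v ∈ e, (∃ w ∈ W, v ∈ w) ∨ 0 < price l v) → ∃ v ∈ e, v ∈ B := by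
    intro e he h
    refine hB e (List.mem_filter.2 ⟨mem_tuples.2 ⟨(hE e he).1, (hE e he).2, fun v hv => ?_⟩,
      by simpa using he⟩)
    exact (hS v).2 (h v hv)
  have hBW : Hits B W := fun w hw =>
    hBe w (packing_subset r k E w hw) fun v hv => .inl ⟨w, hw, hv⟩
  have hsub : ∀ p ∈ W.flatMap (tuples r), p.length = r ∧ ∀ v ∈ p, ∃ w ∈ W, v ∈ w := by
    intro p hp
    obtain ⟨w, hw, hp⟩ := List.mem_flatMap.1 hp
    obtain ⟨h₁, -, h₃⟩ := mem_tuples.1 hp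
    exact ⟨h₁, fun v hv => ⟨w, hw, h₃ v hv⟩⟩
  -- The owner of an item is unique, and its tuple is nonempty since `r ≥ 1`. For items without
  -- owner the value `i` is a dummy.
  have hhead : ∀ i, ∃ u, ∀ p, owns l p i = true → u ∈ p := by
    intro i
    by_cases h : ∃ p, owns l p i = true
    · obtain ⟨p, hp⟩ := h
      have h₁ := (hsub p (hst.mem _ (owns_mem hp)).1).1
      cases p with
      | nil => simp at h₁; omega
      | cons u p =>
        refine ⟨u, fun q hq => ?_⟩
        have h₂ : some (u :: p, i) = some (q, i) := by
          simp only [owns, decide_eq_true_eq] at hp hq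
          rw [← hp, hq]
        simp only [Option.some.injEq, Prod.mk.injEq] at h₂
        rw [← h₂.1]
        exact List.mem_cons_self
    · exact ⟨i, fun p hp => absurd ⟨p, hp⟩ h⟩
  choose u hu using hhead
  -- Vertices of `W` have price zero, so the test `v ∈ I` is needed to keep them fixed.
  let φ : α → α := fun v => if v ∈ I ∧ price l v < d then u v else v
  have hkeep : ∀ v ∈ B, ¬ (v ∈ I ∧ price l v < d) → v ∈ B.image φ := fun v hv h =>
    Finset.mem_image.2 ⟨v, hv, if_neg h⟩
  have hkeepW : ∀ v ∈ B, (∃ w ∈ W, v ∈ w) → v ∈ B.image φ := by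
    rintro v hv ⟨w, hw, hvw⟩
    exact hkeep v hv fun h => ((hmemI v).1 h.1).2 w hw hvw
  refine ⟨B.image φ, Finset.card_image_le.trans hk, fun e he => ?_⟩
  have hle : ∀ e ∈ E, r ≤ e.length := fun e he => by rw [(hE e he).1]; omega
  rcases blocked_iff.1 (blocked_packing (k := k) hle e he) with ⟨w, hw, hew⟩ | ⟨v, hv, hdeg⟩
  · by_cases hin : ∀ v ∈ e, ∃ w ∈ W, v ∈ w
    · obtain ⟨v, hv, hvB⟩ := hBe e he fun v hv => .inl (hin v hv)
      exact ⟨v, hv, hkeepW v hvB (hin v hv)⟩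
    · push Not at hin
      obtain ⟨i, hi, hiW⟩ := hin
      have hiI : i ∈ I := (hmemI i).2 ⟨⟨e, he, hi⟩, hiW⟩
      have hp : e.erase i ∈ W.flatMap (tuples r) := by
        refine List.mem_flatMap.2 ⟨w, hw, mem_tuples.2 ⟨?_, (hE e he).2.erase i, ?_⟩⟩
        · rw [List.length_erase_of_mem hi, (hE e he).1]; rfl
        -- At least `r` of the `r + 1` vertices of `e` lie in `w`, and `i` does not, so `e.erase i`
        -- is exactly the part of `e` in `w`.
        · have h₁ : (e.filter fun v => decide (v ∈ w)).Subperm (e.erase i) := by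
            refine ((hE e he).2.filter _).subperm fun v hv => ?_
            obtain ⟨h₂, h₃⟩ := List.mem_filter.1 hv
            simp only [decide_eq_true_eq] at h₃
            refine ((hE e he).2.mem_erase_iff).2 ⟨?_, h₂⟩
            rintro rfl
            exact hiW w hw h₃
          have h₂ := h₁.perm_of_length_le (by
            rw [List.length_erase_of_mem hi, (hE e he).1]; exact hew)
          intro v hv
          simpa using (List.mem_filter.1 (h₂.mem_iff.2 hv)).2
      have hadj : i :: e.erase i ∈ E := hperm e he _ (List.perm_cons_erase hi).symm
      have hsubp := (hsub _ hp).2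
      by_cases hprice : price l i < d
      · obtain ⟨j, hj, hjd⟩ := hlevel _ hp i hiI (by simpa using hadj) hprice
        have hjE : j :: e.erase i ∈ E := by simpa using (hst.mem _ (owns_mem hj)).2.2
        have hjI : j ∈ I := (hst.mem _ (owns_mem hj)).2.1
        obtain ⟨v, hv, hvB⟩ := hBe _ hjE fun v hv => by
          rcases List.mem_cons.1 hv with rfl | hv
          · exact .inr (price_pos_of_owns hj)
          · exact .inl (hsubp v hv)
        rcases List.mem_cons.1 hv with rfl | hv
        · exact ⟨u v, List.mem_of_mem_erase (hu v _ hj),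
            Finset.mem_image.2 ⟨v, hvB, if_pos ⟨hjI, hjd⟩⟩⟩
        · exact ⟨v, List.mem_of_mem_erase hv, hkeepW v hvB (hsubp v hv)⟩
      -- As `d ≥ 1`, the price of `i` is positive, so `i` is a kernel vertex that `φ` fixes.
      · obtain ⟨v, hv, hvB⟩ := hBe _ hadj fun v hv => by
          rcases List.mem_cons.1 hv with rfl | hv
          · exact .inr (by omega)
          · exact .inl (hsubp v hv)
        rcases List.mem_cons.1 hv with rfl | hv
        · exact ⟨v, hi, hkeep v hvB fun h => hprice h.2⟩
        · exact ⟨v, List.mem_of_mem_erase hv, hkeepW v hvB (hsubp v hv)⟩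
  · have hvB := mem_of_lt_degree (by omega) hBW hk hdeg
    obtain ⟨w, hw⟩ := List.exists_mem_of_length_pos (Nat.zero_lt_of_lt hdeg)
    have hw' := List.mem_filter.1 hw
    exact ⟨v, hv, hkeepW v hvB ⟨w, hw'.1, by simpa using hw'.2⟩⟩

end Kernel

/-! ### Backdoors as hitting sets -/

/-- The formulas whose clauses have at most `r` literals with a sign selected by `q`. -/
def signBounded (q : Bool → Bool) (r : ℕ) : Set Formula :=
  {F | ∀ C ∈ F, (C.filter fun l => q l.2 = true).card ≤ r}

theorem horn_eq : Horn = signBounded (fun b => b) 1 := rfl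

theorem cnf_eq (r : ℕ) : CNF r = signBounded (fun _ => true) r := by
  simp [CNF, signBounded]

/-- The variables of the literals with a sign selected by `q`. -/
def selectedVars (q : Bool → Bool) (C : List Literal) : List Var :=
  (C.filter fun l => q l.2).map Prod.fst

/-- All lists of `r + 1` distinct selected variables of a clause. -/
def edges (r : ℕ) (q : Bool → Bool) (L : List (List Literal)) : List (List Var) :=
  L.flatMap fun C => tuples (r + 1) (selectedVars q C)

/-- The formula given by a list of clauses. -/
def formulaOfList (L : List (List Literal)) : Formula := (L.map List.toFinset).toFinset

/-- The worst assignment for `C` falsifies all its literals on `B`, and any assignment to `B` that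
does not satisfy `C` removes the same literals. That clauses are not tautological makes this
assignment exist and lets variables be counted instead of literals. -/
theorem isBackdoor_signBounded_iff {q : Bool → Bool} {r : ℕ} {F : Formula}
    (hF : NonTautological F) (B : Finset Var) : IsBackdoor (signBounded q r) F B ↔
      ∀ C ∈ F, (((C.filter fun l => q l.2 = true).image Prod.fst) \ B).card ≤ r := by
  constructor
  · intro h C hC
    -- On variables of `B` that do not occur in `C` the value `true` is arbitrary.
    let τ : PartialAssignment := fun v =>
      if v ∈ B then some (if (v, true) ∈ C then false else true) else none
    have hτ : ∀ v, (τ v).isSome ↔ v ∈ B := by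
      intro v
      by_cases hv : v ∈ B <;> simp [τ, hv]
    have hmem : (C.filter fun l => τ l.1 ≠ some (!l.2)) ∈ applyAssignment F τ := by
      refine Finset.mem_image_of_mem _ (Finset.mem_filter.2 ⟨hC, ?_⟩)
      rintro ⟨⟨v, b⟩, hl, hb⟩
      have hnt := hF C hC v
      by_cases hv : v ∈ B
      · cases b <;> simp [τ, hv] at hb
        · exact hnt ⟨hb, hl⟩
        · exact hb hl
      · simp [τ, hv] at hb
    refine le_trans (Finset.card_le_card ?_)
      ((Finset.card_image_le (f := Prod.fst)).trans (h τ hτ _ hmem))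
    intro v hv
    simp only [Finset.mem_sdiff, Finset.mem_image, Finset.mem_filter] at hv ⊢
    obtain ⟨⟨l, ⟨hl, hq⟩, rfl⟩, hB⟩ := hv
    exact ⟨l, ⟨⟨hl, by simp [τ, hB]⟩, hq⟩, rfl⟩
  · intro h τ hτ C' hC'
    obtain ⟨C, hC, rfl⟩ := Finset.mem_image.1 hC'
    obtain ⟨hC, hsat⟩ := Finset.mem_filter.1 hC
    refine le_trans ?_ (h C hC)
    refine Finset.card_le_card_of_injOn Prod.fst ?_ ?_
    · intro l hl
      simp only [Finset.mem_coe, Finset.mem_filter] at hl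
      simp only [Finset.mem_coe, Finset.mem_sdiff, Finset.mem_image, Finset.mem_filter]
      refine ⟨⟨l, ⟨hl.1.1, hl.2⟩, rfl⟩, fun hB => ?_⟩
      obtain ⟨b, hb⟩ := Option.isSome_iff_exists.1 ((hτ l.1).2 hB)
      by_cases hbl : b = l.2
      · exact hsat ⟨l, hl.1.1, by rw [hb, hbl]⟩
      · exact hl.1.2 (by rw [hb, Bool.eq_not.2 hbl])
    · rintro ⟨v, b⟩ hl ⟨w, c⟩ hl' (rfl : v = w)
      simp only [Finset.mem_coe, Finset.mem_filter] at hl hl'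
      have hnt := hF C hC v
      cases b <;> cases c
      · rfl
      · exact absurd ⟨hl'.1.1, hl.1.1⟩ hnt
      · exact absurd ⟨hl.1.1, hl'.1.1⟩ hnt
      · rfl

theorem exists_mem_tuples_iff {α : Type} [DecidableEq α] {r : ℕ} {V : List α} {B : Finset α} :
    Hits B (tuples (r + 1) V) ↔ (V.toFinset \ B).card ≤ r := by
  constructor
  · intro h
    by_contra h'
    obtain ⟨T, hT, hcard⟩ := Finset.exists_subset_card_eq (not_le.1 h' : r + 1 ≤ _)
    obtain ⟨v, hv, hvB⟩ := h T.toList (mem_tuples.2 ⟨by simp [hcard], T.nodup_toList,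
      fun v hv => List.mem_toFinset.1 (Finset.mem_sdiff.1 (hT (Finset.mem_toList.1 hv))).1⟩)
    exact (Finset.mem_sdiff.1 (hT (Finset.mem_toList.1 hv))).2 hvB
  · intro h t ht
    obtain ⟨h₁, h₂, h₃⟩ := mem_tuples.1 ht
    by_contra! h'
    have : t.toFinset ⊆ V.toFinset \ B := fun v hv => by
      rw [List.mem_toFinset] at hv
      exact Finset.mem_sdiff.2 ⟨List.mem_toFinset.2 (h₃ v hv), h' v hv⟩
    have := Finset.card_le_card this
    rw [List.toFinset_card_of_nodup h₂] at this
    omega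

theorem isBackdoor_formulaOfList_iff {q : Bool → Bool} {r : ℕ} {L : List (List Literal)}
    (hL : NonTautological (formulaOfList L)) (B : Finset Var) :
    IsBackdoor (signBounded q r) (formulaOfList L) B ↔ Hits B (edges r q L) := by
  rw [isBackdoor_signBounded_iff hL]
  have h : Hits B (edges r q L) ↔ ∀ C ∈ L, Hits B (tuples (r + 1) (selectedVars q C)) := by
    simp only [Hits, edges, List.mem_flatMap]
    exact ⟨fun h C hC e he => h e ⟨C, hC, he⟩, fun h e ⟨C, hC, he⟩ => h C hC e he⟩
  rw [h]
  simp only [exists_mem_tuples_iff, formulaOfList, List.mem_toFinset, List.mem_map,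
    forall_exists_index, and_imp, forall_apply_eq_imp_iff₂]
  refine forall₂_congr fun C _ => ?_
  have : (selectedVars q C).toFinset =
      (C.toFinset.filter fun l => q l.2 = true).image Prod.fst := by
    ext v
    simp [selectedVars]
  rw [this]

theorem edges_spec {r : ℕ} {q : Bool → Bool} {L : List (List Literal)} :
    ∀ e ∈ edges r q L, e.length = r + 1 ∧ e.Nodup := by
  intro e he
  obtain ⟨C, -, he⟩ := List.mem_flatMap.1 he
  exact ⟨(mem_tuples.1 he).1, (mem_tuples.1 he).2.1⟩

theorem edges_perm {r : ℕ} {q : Bool → Bool} {L : List (List Literal)} :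
    ∀ e ∈ edges r q L, ∀ f, f.Perm e → f ∈ edges r q L := by
  intro e he f hf
  obtain ⟨C, hC, he⟩ := List.mem_flatMap.1 he
  obtain ⟨h₁, h₂, h₃⟩ := mem_tuples.1 he
  exact List.mem_flatMap.2 ⟨C, hC, mem_tuples.2
    ⟨hf.length_eq.trans h₁, hf.nodup_iff.2 h₂, fun v hv => h₃ v (hf.mem_iff.1 hv)⟩⟩

/-! ### Words and formulas -/

/-- Add a literal to the first clause. -/
def addLiteral (l : Literal) : List (List Literal) → List (List Literal)
  | [] => []
  | C :: L => (l :: C) :: L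

/-- Read one symbol from right to left; the state consists of the digits that have been read after
the last sign, and of the clauses that have been read. -/
def decodeStep (s : Sym) (st : List Bool × List (List Literal)) :
    List Bool × List (List Literal) :=
  if s = .zero then (false :: st.1, st.2)
  else if s = .one then (true :: st.1, st.2)
  else if s = .pos then ([], addLiteral (st.1, true) st.2)
  else if s = .neg then ([], addLiteral (st.1, false) st.2)
  else ([], [] :: st.2)

/-- The list of clauses that a word represents (with an arbitrary value on other words). -/
def decode (x : List Sym) : List (List Literal) := (x.foldr decodeStep ([], [])).2

theorem foldr_decodeStep_encodeLiteral (l : Literal) (C : List Literal)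
    (L : List (List Literal)) :
    (encodeLiteral l).foldr decodeStep ([], C :: L) = ([], (l :: C) :: L) := by
  obtain ⟨v, b⟩ := l
  have h : ∀ st : List (List Literal),
      (v.map fun b => if b then Sym.one else Sym.zero).foldr decodeStep ([], st) = (v, st) := by
    intro st
    induction v with
    | nil => rfl
    | cons a v ih =>
      rw [List.map_cons, List.foldr_cons, ih]
      cases a <;> simp [decodeStep]
  rw [encodeLiteral, List.foldr_cons, h]
  cases b <;> simp [decodeStep, addLiteral]

theorem foldr_decodeStep_encodeClause (C : List Literal) (L : List (List Literal)) :
    (encodeClause C).foldr decodeStep ([], L) = ([], C :: L) := by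
  induction C with
  | nil => simp [encodeClause, decodeStep]
  | cons l C ih =>
    rw [encodeClause] at ih ⊢
    rw [List.flatMap_cons, List.append_assoc, List.foldr_append, ih,
      foldr_decodeStep_encodeLiteral]

theorem decode_flatMap_encodeClause (L : List (List Literal)) :
    decode (L.flatMap encodeClause) = L := by
  have h : (L.flatMap encodeClause).foldr decodeStep ([], []) = ([], L) := by
    induction L with
    | nil => rfl
    | cons C L ih =>
      rw [List.flatMap_cons, List.foldr_append, ih, foldr_decodeStep_encodeClause]
  rw [decode, h]

/-- The left inverse `decode` shows that a word determines its list of clauses, so no second formula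
can be represented by it. -/
theorem encodes_iff {L : List (List Literal)} {F : Formula} :
    Encodes (L.flatMap encodeClause) F ↔ NonTautological F ∧ F = formulaOfList L := by
  refine and_congr_right fun _ => ⟨?_, fun h => ⟨L, rfl, h⟩⟩
  rintro ⟨L', h, rfl⟩
  have := congrArg decode h
  rw [decode_flatMap_encodeClause, decode_flatMap_encodeClause] at this
  rw [this, formulaOfList]

theorem mem_backdoorRecognition_iff {q : Bool → Bool} {r k : ℕ} {L : List (List Literal)}
    (hL : NonTautological (formulaOfList L)) :
    (L.flatMap encodeClause, k) ∈ BackdoorRecognition (signBounded q r) ↔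
      ∃ B : Finset Var, B.card ≤ k ∧ Hits B (edges r q L) := by
  simp only [BackdoorRecognition, Set.mem_ofPred_eq, encodes_iff]
  constructor
  · rintro ⟨F, ⟨-, rfl⟩, B, hB, h⟩
    exact ⟨B, hB, (isBackdoor_formulaOfList_iff hL B).1 h⟩
  · rintro ⟨B, hB, h⟩
    exact ⟨_, ⟨hL, rfl⟩, B, hB, (isBackdoor_formulaOfList_iff hL B).2 h⟩

/-- The word represents a CNF formula. -/
def wellFormed (x : List Sym) : Bool :=
  decide ((decode x).flatMap encodeClause = x) &&
    (decode x).all fun C => C.all fun l => !decide ((l.1, !l.2) ∈ C)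

theorem nonTautological_formulaOfList_iff {L : List (List Literal)} :
    NonTautological (formulaOfList L) ↔ ∀ C ∈ L, ∀ l ∈ C, (l.1, !l.2) ∉ C := by
  simp only [NonTautological, formulaOfList, List.mem_toFinset, List.mem_map, forall_exists_index,
    and_imp, forall_apply_eq_imp_iff₂]
  refine forall₂_congr fun C _ => ⟨?_, fun h v hv => h _ hv.1 hv.2⟩
  rintro h ⟨v, b⟩ hl hl'
  cases b
  · exact h v ⟨hl', hl⟩
  · exact h v ⟨hl, hl'⟩

theorem wellFormed_iff {x : List Sym} : wellFormed x = true ↔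
    (decode x).flatMap encodeClause = x ∧ NonTautological (formulaOfList (decode x)) := by
  simp [wellFormed, nonTautological_formulaOfList_iff]

theorem wellFormed_of_encodes {x : List Sym} {F : Formula} (h : Encodes x F) :
    wellFormed x = true := by
  obtain ⟨hF, L, rfl, rfl⟩ := h
  rw [wellFormed_iff, decode_flatMap_encodeClause]
  exact ⟨rfl, hF⟩

/-! ### Hypergraphs as formulas -/

section PositiveClauses

variable {α : Type}

/-- Every edge as a clause of positive literals, with new names for the vertices. -/
def positiveClauses (f : α → Var) (E : List (List α)) : List (List Literal) :=
  E.map fun e => e.map fun v => (f v, true)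

theorem nonTautological_positiveClauses (f : α → Var) (E : List (List α)) :
    NonTautological (formulaOfList (positiveClauses f E)) := by
  rw [nonTautological_formulaOfList_iff]
  intro C hC l hl h
  obtain ⟨e, -, rfl⟩ := List.mem_map.1 hC
  obtain ⟨v, -, rfl⟩ := List.mem_map.1 hl
  simp at h

theorem encodes_positiveClauses (f : α → Var) (E : List (List α)) :
    Encodes ((positiveClauses f E).flatMap encodeClause)
      (formulaOfList (positiveClauses f E)) :=
  encodes_iff.2 ⟨nonTautological_positiveClauses f E, rfl⟩

theorem card_vars_positiveClauses_le [DecidableEq α] {f : α → Var} {E : List (List α)}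
    {S : List α} (h : ∀ e ∈ E, ∀ v ∈ e, v ∈ S) :
    (vars (formulaOfList (positiveClauses f E))).card ≤ S.length := by
  have : vars (formulaOfList (positiveClauses f E)) ⊆ (S.map f).toFinset := by
    intro u hu
    simp only [vars, formulaOfList, positiveClauses, Finset.mem_biUnion, List.mem_toFinset,
      List.mem_map, exists_exists_and_eq_and, Finset.mem_image] at hu
    obtain ⟨e, he, v, hv, rfl⟩ := hu
    exact List.mem_toFinset.2 (List.mem_map_of_mem (h e he v hv))
  exact (Finset.card_le_card this).trans ((List.toFinset_card_le _).trans (by simp))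

theorem length_encode_positiveClauses_le {f : α → Var} {E : List (List α)} {n s : ℕ}
    (hE : ∀ e ∈ E, e.length = n) (hf : ∀ v, (f v).length ≤ s) :
    ((positiveClauses f E).flatMap encodeClause).length ≤ E.length * (n * (s + 1) + 1) := by
  refine (length_flatMap_le _ _ (n * (s + 1) + 1) fun C hC => ?_).trans (by simp [positiveClauses])
  obtain ⟨e, he, rfl⟩ := List.mem_map.1 hC
  have := length_flatMap_le (e.map fun v => (f v, true)) encodeLiteral (s + 1) fun l hl => by
    obtain ⟨v, -, rfl⟩ := List.mem_map.1 hl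
    simpa [encodeLiteral] using hf v
  rw [List.length_map, hE e he] at this
  simpa [encodeClause] using this

/-- Positive literals are selected, so each clause yields its renamed edge up to order, and hitting
sets are carried along `f`. Injectivity is needed only on the vertex set `S`. -/
theorem positiveClauses_mem_backdoorRecognition_iff [DecidableEq α] {q : Bool → Bool}
    (hq : q true = true) {r k : ℕ} {f : α → Var} {E : List (List α)} {S : List α}
    (hE : ∀ e ∈ E, e.length = r + 1 ∧ e.Nodup ∧ ∀ v ∈ e, v ∈ S)
    (hf : ∀ u ∈ S, ∀ v ∈ S, f u = f v → u = v) :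
    ((positiveClauses f E).flatMap encodeClause, k) ∈ BackdoorRecognition (signBounded q r) ↔
      ∃ B : Finset α, B.card ≤ k ∧ Hits B E := by
  rw [mem_backdoorRecognition_iff (nonTautological_positiveClauses f E)]
  have hsel : ∀ e : List α, selectedVars q (e.map fun v => (f v, true)) = e.map f := by
    intro e
    rw [selectedVars, List.filter_eq_self.2]
    · simp
    · intro l hl
      obtain ⟨v, -, rfl⟩ := List.mem_map.1 hl
      exact hq
  have hedges : ∀ t, t ∈ edges r q (positiveClauses f E) ↔
      ∃ e ∈ E, t ∈ tuples (r + 1) (e.map f) := by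
    intro t
    simp [edges, positiveClauses, hsel]
  have hnodup : ∀ e ∈ E, (e.map f).Nodup := fun e he =>
    (hE e he).2.1.map_on fun u hu v hv => hf u ((hE e he).2.2 u hu) v ((hE e he).2.2 v hv)
  constructor
  · rintro ⟨B, hk, hB⟩
    refine ⟨S.toFinset.filter fun v => f v ∈ B, le_trans ?_ hk, fun e he => ?_⟩
    · refine Finset.card_le_card_of_injOn f (fun v hv => ?_) fun u hu v hv => ?_
      · exact (Finset.mem_filter.1 hv).2
      · exact hf u (List.mem_toFinset.1 (Finset.mem_filter.1 hu).1) v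
          (List.mem_toFinset.1 (Finset.mem_filter.1 hv).1)
    · obtain ⟨u, hu, huB⟩ := hB (e.map f) ((hedges _).2 ⟨e, he, mem_tuples.2
        ⟨by rw [List.length_map, (hE e he).1], hnodup e he, fun _ h => h⟩⟩)
      obtain ⟨v, hv, rfl⟩ := List.mem_map.1 hu
      exact ⟨v, hv, Finset.mem_filter.2 ⟨List.mem_toFinset.2 ((hE e he).2.2 v hv), huB⟩⟩
  · rintro ⟨B, hk, hB⟩
    refine ⟨B.image f, Finset.card_image_le.trans hk, fun t ht => ?_⟩
    obtain ⟨e, he, ht⟩ := (hedges t).1 ht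
    obtain ⟨h₁, h₂, h₃⟩ := mem_tuples.1 ht
    obtain ⟨v, hv, hvB⟩ := hB e he
    have hperm : t.Perm (e.map f) := (h₂.subperm h₃).perm_of_length_le (by
      rw [List.length_map, (hE e he).1, h₁])
    exact ⟨f v, hperm.mem_iff.2 (List.mem_map_of_mem hv), Finset.mem_image_of_mem f hvB⟩

/-- The position of the first occurrence in a list as a word. -/
def unaryName [DecidableEq α] (S : List α) (v : α) : Var :=
  S.foldr (fun a s => if a = v then [] else true :: s) []

theorem unaryName_cons [DecidableEq α] (a : α) (S : List α) (v : α) :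
    unaryName (a :: S) v = if a = v then [] else true :: unaryName S v := rfl

theorem length_unaryName_le [DecidableEq α] (S : List α) (v : α) :
    (unaryName S v).length ≤ S.length := by
  induction S with
  | nil => simp [unaryName]
  | cons a S ih =>
    rw [unaryName_cons]
    split <;> simp [ih]

theorem unaryName_injOn [DecidableEq α] (S : List α) :
    ∀ u ∈ S, ∀ v ∈ S, unaryName S u = unaryName S v → u = v := by
  induction S with
  | nil => simp
  | cons a S ih =>
    intro u hu v hv h
    rw [unaryName_cons, unaryName_cons] at h
    split_ifs at h with h₁ h₂ h₂
    · rw [← h₁, h₂]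
    · rw [List.cons.injEq] at h
      exact ih u ((List.mem_cons.1 hu).resolve_left fun h => h₁ h.symm) v
        ((List.mem_cons.1 hv).resolve_left fun h => h₂ h.symm) h.2

end PositiveClauses

/-! ### The kernelization -/

/-- The bound on the number of edges in a packing. -/
def packingBound (r k : ℕ) : ℕ := k * ((r - 1) * k + 1)

/-- The clauses of a formula without a backdoor of size zero. -/
def noInstance (r : ℕ) : List (List Literal) :=
  positiveClauses (fun n => List.replicate n true) [List.range (r + 1)]

/-- The kernelization for the class `signBounded q r`. -/
def kernelization (r : ℕ) (q : Bool → Bool) (I : List Sym × ℕ) : List Sym × ℕ :=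
  bif wellFormed I.1 &&
      decide ((packing r I.2 (edges r q (decode I.1))).length ≤ packingBound r I.2) then
    ((positiveClauses
        (unaryName (kernelVertices r (packing r I.2 (edges r q (decode I.1)))
          (edges r q (decode I.1))))
        (kernelEdges r (packing r I.2 (edges r q (decode I.1)))
          (edges r q (decode I.1)))).flatMap encodeClause, I.2)
  else ((noInstance r).flatMap encodeClause, 0)

theorem kernelEdges_spec {α : Type} [DecidableEq α] {r : ℕ} {W E : List (List α)} :
    ∀ e ∈ kernelEdges r W E,
      e.length = r + 1 ∧ e.Nodup ∧ ∀ v ∈ e, v ∈ kernelVertices r W E := fun _ he =>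
  mem_tuples.1 (List.mem_filter.1 he).1

theorem noInstance_notMem {q : Bool → Bool} (hq : q true = true) (r : ℕ) :
    ((noInstance r).flatMap encodeClause, 0) ∉ BackdoorRecognition (signBounded q r) := by
  rw [noInstance, positiveClauses_mem_backdoorRecognition_iff hq (S := List.range (r + 1))]
  · rintro ⟨B, hB, h⟩
    obtain ⟨v, -, hv⟩ := h _ List.mem_cons_self
    rw [Nat.le_zero, Finset.card_eq_zero] at hB
    simp [hB] at hv
  · intro e he
    rw [List.mem_singleton] at he
    subst he
    exact ⟨by simp, List.nodup_range, fun _ h => h⟩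
  · intro u _ v _ h
    simpa using congrArg List.length h

theorem kernelization_correct {r : ℕ} (hr : r = 1 ∨ r = 2) {q : Bool → Bool}
    (hq : q true = true) (I : List Sym × ℕ) :
    I ∈ BackdoorRecognition (signBounded q r) ↔
      kernelization r q I ∈ BackdoorRecognition (signBounded q r) := by
  obtain ⟨x, k⟩ := I
  rw [kernelization]
  cases hx : wellFormed x with
  | false =>
    refine iff_of_false ?_ (noInstance_notMem hq r)
    rintro ⟨F, hF, -⟩
    rw [wellFormed_of_encodes hF] at hx
    exact absurd hx (by simp)
  | true =>
    obtain ⟨h₁, h₂⟩ := wellFormed_iff.1 hx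
    have h₃ := mem_backdoorRecognition_iff (q := q) (r := r) (k := k) h₂
    rw [h₁] at h₃
    rw [h₃]
    simp only [Bool.true_and]
    set E := edges r q (decode x)
    by_cases hW : (packing r k E).length ≤ packingBound r k
    · rw [decide_eq_true hW, cond_true, positiveClauses_mem_backdoorRecognition_iff hq
        kernelEdges_spec (unaryName_injOn _)]
      constructor
      · rintro ⟨B, hk, hB⟩
        refine ⟨B, hk, fun e he => hB e ?_⟩
        simpa using (List.mem_filter.1 he).2
      · rintro ⟨B, hk, hB⟩
        exact exists_hits_of_hits_kernelEdges hr edges_spec edges_perm hB hk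
    -- A packing above the bound cannot be hit by `k` vertices, so the constant no-instance is a
    -- correct answer.
    · rw [decide_eq_false hW, cond_false]
      refine iff_of_false ?_ (noInstance_notMem hq r)
      rintro ⟨B, hk, hB⟩
      exact hW (length_packing_le hr (fun e he => hB e (packing_subset r k E e he)) hk)

/-- The bound on the number of variables of the kernel. -/
def vertexBound (r k : ℕ) : ℕ := packingBound r k * (r + 1 + (r + 1) ^ r)

theorem length_kernelVertices_packing_le {r k : ℕ} {q : Bool → Bool} {L : List (List Literal)}
    (h : (packing r k (edges r q L)).length ≤ packingBound r k) :
    (kernelVertices r (packing r k (edges r q L)) (edges r q L)).length ≤ vertexBound r k :=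
  (length_kernelVertices_le fun w hw => (edges_spec w (packing_subset _ _ _ w hw)).1).trans
    (Nat.mul_le_mul_right _ h)

/-- The term `r + 1` counts the variables of the constant no-instance. -/
theorem kernelization_vars (r : ℕ) (q : Bool → Bool) (I : List Sym × ℕ) :
    ∃ F, Encodes (kernelization r q I).1 F ∧ (vars F).card ≤ max (r + 1) (vertexBound r I.2) := by
  rw [kernelization]
  by_cases h : (wellFormed I.1 && decide ((packing r I.2 (edges r q (decode I.1))).length ≤
    packingBound r I.2)) = true
  · rw [h, cond_true]
    refine ⟨_, encodes_positiveClauses _ _, le_max_of_le_right ?_⟩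
    refine (card_vars_positiveClauses_le fun e he => (kernelEdges_spec e he).2.2).trans
      (length_kernelVertices_packing_le ?_)
    simpa using (Bool.and_eq_true_iff.1 h).2
  · rw [Bool.eq_false_iff.2 h, cond_false]
    refine ⟨_, encodes_positiveClauses _ _, le_max_of_le_left ?_⟩
    refine (card_vars_positiveClauses_le (S := List.range (r + 1)) fun e he v hv => ?_).trans
      (by simp)
    rwa [List.mem_singleton.1 he] at hv

theorem kernelization_length (r : ℕ) (q : Bool → Bool) (I : List Sym × ℕ) :
    (kernelization r q I).1.length + (kernelization r q I).2 ≤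
      vertexBound r I.2 ^ (r + 1) * ((r + 1) * (vertexBound r I.2 + 1) + 1) + I.2 +
        ((noInstance r).flatMap encodeClause).length := by
  rw [kernelization]
  by_cases h : (wellFormed I.1 && decide ((packing r I.2 (edges r q (decode I.1))).length ≤
    packingBound r I.2)) = true
  · rw [h, cond_true]
    have hS := length_kernelVertices_packing_le (r := r) (k := I.2) (q := q) (L := decode I.1)
      (by simpa using (Bool.and_eq_true_iff.1 h).2)
    generalize packing r I.2 (edges r q (decode I.1)) = W at *
    -- Input names can be arbitrarily long; a unary name is no longer than the number of kernel
    -- vertices.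
    have h₁ := length_encode_positiveClauses_le
      (f := unaryName (kernelVertices r W (edges r q (decode I.1))))
      (E := kernelEdges r W (edges r q (decode I.1))) (fun e he => (kernelEdges_spec e he).1)
      fun v => (length_unaryName_le _ v).trans hS
    -- Kernel edges are enumerated as tuples of kernel vertices; a sublist of the input edges could
    -- contain repetitions not bounded in `k`.
    have h₂ : (kernelEdges r W (edges r q (decode I.1))).length ≤ vertexBound r I.2 ^ (r + 1) :=
      (List.length_filter_le _ _).trans ((length_tuples_le _ _).trans
        (Nat.pow_le_pow_left hS _))
    have h₃ := h₁.trans (Nat.mul_le_mul_right _ h₂)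
    simp only
    omega
  · rw [Bool.eq_false_iff.2 h, cond_false]
    simp only
    omega

theorem exists_polynomial_kernelization_length (r : ℕ) (q : Bool → Bool) :
    ∃ g : Polynomial ℕ, ∀ (x : List Sym) (k : ℕ),
      (kernelization r q (x, k)).1.length + (kernelization r q (x, k)).2 ≤ g.eval k := by
  let M : Polynomial ℕ := .X * (.C (r - 1) * .X + 1) * .C (r + 1 + (r + 1) ^ r)
  have hM : ∀ k, M.eval k = vertexBound r k := fun k => by simp [M, vertexBound, packingBound]
  refine ⟨M ^ (r + 1) * (.C (r + 1) * (M + 1) + 1) + .X +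
    .C ((noInstance r).flatMap encodeClause).length, fun x k => ?_⟩
  simp only [Polynomial.eval_add, Polynomial.eval_mul, Polynomial.eval_pow, Polynomial.eval_one,
    Polynomial.eval_C, Polynomial.eval_X, hM]
  exact kernelization_length r q (x, k)

/-! ### The kernelization takes polynomial time -/

namespace PolyTime

variable {α β γ ι : Type} [TreeCode α] [TreeCode β] [TreeCode γ] [TreeCode ι]

/-- The length `n` is fixed outside the program: each `n` has its own program and its own
polynomial. -/
theorem tuples [DecidableEq α] (n : ℕ) {V : γ → List α} (hV : PolyTime V) :
    PolyTime fun c => tuples n (V c) := by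
  induction n with
  | zero => exact const [[]]
  | succ n ih =>
    exact hV.flatMap (f := fun c v => ((BackdoorKernel.tuples n (V c)).filter
        fun t => !decide (v ∈ t)).map fun t => v :: t)
      (((ih.comp fst).filter (f := fun x t => !decide (x.2 ∈ t)) (mem fst.snd' snd).not).map
        (f := fun x t => x.2 :: t) (fst.snd'.cons snd))

theorem blocked [DecidableEq α] (r : ℕ) {k : γ → ℕ} {W : γ → List (List α)} {e : γ → List α}
    (hk : PolyTime k) (hW : PolyTime W) (he : PolyTime e) :
    PolyTime fun c => blocked r (k c) (W c) (e c) := by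
  refine or ?_ ?_
  · exact hW.any (f := fun c w => decide (r ≤ ((e c).filter fun v => decide (v ∈ w)).length))
      (le (const r) ((he.comp fst).filter (f := fun x v => decide (v ∈ x.2))
        (mem snd fst.snd')).length)
  · exact he.any (f := fun c v => decide (k c < ((W c).filter fun w => decide (v ∈ w)).length))
      (lt (hk.comp fst) ((hW.comp fst).filter (f := fun x w => decide (x.2 ∈ w))
        (mem fst.snd' snd)).length)

theorem packing [DecidableEq α] (r : ℕ) {k : γ → ℕ} {E : γ → List (List α)} (hk : PolyTime k)
    (hE : PolyTime E) : PolyTime fun c => packing r (k c) (E c) := by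
  refine foldr (f := fun c e W => bif BackdoorKernel.blocked r (k c) W e then W else e :: W)
    (cond (blocked r (hk.comp fst) snd.fst' snd.snd') snd.fst' (snd.snd'.cons snd.fst'))
    (const []) hE (.X + 1) fun c e W => ?_
  simp only [csize_prod, Polynomial.eval_add, Polynomial.eval_X, Polynomial.eval_one]
  cases BackdoorKernel.blocked r (k c) W e
  · rw [cond_false, csize_cons]; omega
  · rw [cond_true]; omega

theorem price [DecidableEq ι] {l : γ → List (β × ι)} {i : γ → ι}
    (hl : PolyTime l) (hi : PolyTime i) : PolyTime fun c => price (l c) (i c) :=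
  (hl.filter (f := fun c (b : β × ι) => decide (b.2 = i c)) (snd.snd'.eq (hi.comp fst))).length

theorem owns [DecidableEq β] [DecidableEq ι] {l : γ → List (β × ι)} {p : γ → β}
    {i : γ → ι} (hl : PolyTime l) (hp : PolyTime p) (hi : PolyTime i) :
    PolyTime fun c => owns (l c) (p c) (i c) :=
  (hl.find? (f := fun c (b : β × ι) => decide (b.2 = i c)) (snd.snd'.eq (hi.comp fst))).eq
    (hp.pair hi).some

theorem validBid [DecidableEq β] [DecidableEq ι] {adj : γ → β → ι → Bool} {m : γ → ℕ}
    {I : γ → List ι} {l : γ → List (β × ι)} {b : γ → β × ι}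
    (hadj : PolyTime fun x : γ × β × ι => adj x.1 x.2.1 x.2.2) (hm : PolyTime m)
    (hI : PolyTime I) (hl : PolyTime l) (hb : PolyTime b) :
    PolyTime fun c => validBid (adj c) (m c) (I c) (l c) (b c) := by
  have h₁ : PolyTime fun c => adj c (b c).1 (b c).2 := hadj.comp (id.pair (hb.fst'.pair hb.snd'))
  have h₂ : PolyTime fun x : γ × ι => adj x.1 (b x.1).1 x.2 :=
    hadj.comp (fst.pair ((hb.fst'.comp fst).pair snd))
  refine ((h₁.and ?_).and ((hl.price hb.snd').le hm)).and ?_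
  · exact hI.all (f := fun c j => !BackdoorKernel.owns (l c) (b c).1 j)
      (owns (hl.comp fst) (hb.fst'.comp fst) snd).not
  · exact hI.all (f := fun c j => !adj c (b c).1 j ||
        decide (BackdoorKernel.price (l c) (b c).2 ≤ BackdoorKernel.price (l c) j))
      (h₂.not.or (le (price (hl.comp fst) (hb.snd'.comp fst)) (price (hl.comp fst) snd)))

theorem auction [DecidableEq β] [DecidableEq ι] {adj : γ → β → ι → Bool} {A : γ → List β}
    {I : γ → List ι} (hadj : PolyTime fun x : γ × β × ι => adj x.1 x.2.1 x.2.2) (hA : PolyTime A)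
    (hI : PolyTime I) : PolyTime fun c => auction (adj c) (A c) (I c) := by
  have hpairs : PolyTime fun c => (A c).flatMap fun p => (I c).map fun i => (p, i) :=
    hA.flatMap (f := fun c p => (I c).map fun i => (p, i))
      ((hI.comp fst).map (f := fun x i => (x.2, i)) (fst.snd'.pair snd))
  have hstep : PolyTime fun x : γ × List (β × ι) × Unit =>
      auctionStep (adj x.1) (A x.1) (I x.1) x.2.1 := by
    refine append (toList (find? (hpairs.comp fst) (f := fun (x : γ × List (β × ι) × Unit) b =>
      BackdoorKernel.validBid (adj x.1) (A x.1).length (I x.1) x.2.1 b) ?_)) snd.fst'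
    exact validBid (adj := fun (x : (γ × List (β × ι) × Unit) × β × ι) => adj x.1.1)
      (hadj.comp (fst.fst'.fst'.pair snd)) (hA.length.comp fst.fst') (hI.comp fst.fst')
      fst.snd'.fst' snd
  obtain ⟨Q, hQ⟩ := hpairs.csize_le
  refine foldr (f := fun c _ l => auctionStep (adj c) (A c) (I c) l) hstep (const [])
    ((hI.length.mul (hA.length.add (const 1))).add (const 1)).replicate_unit (Q + 1)
    fun c u l => ?_
  rw [auctionStep]
  have h₁ := csize_append ((((A c).flatMap fun p => (I c).map fun i => (p, i)).find?
    (BackdoorKernel.validBid (adj c) (A c).length (I c) l)).toList) l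
  -- A list with one bid has size two more than the bid, and appending saves one leaf, which gives
  -- the growth `Q + 1` per round.
  have h₂ : csize (((A c).flatMap fun p => (I c).map fun i => (p, i)).find?
      (BackdoorKernel.validBid (adj c) (A c).length (I c) l)).toList ≤
      Q.eval (csize (c, u)) + 2 := by
    cases h : ((A c).flatMap fun p => (I c).map fun i => (p, i)).find?
      (BackdoorKernel.validBid (adj c) (A c).length (I c) l) with
    | none => rw [Option.toList_none, csize_nil]; omega
    | some b =>
      have h₃ := (csize_le_of_mem (List.mem_of_find?_eq_some h)).trans (hQ c)
      have h₄ := eval_mono_right Q (show csize c ≤ csize (c, u) by rw [csize_prod]; omega)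
      rw [Option.toList_some, csize_cons, csize_nil]
      omega
  simp only [Polynomial.eval_add, Polynomial.eval_one]
  omega

theorem tupleAuction [DecidableEq α] (r : ℕ) {W E : γ → List (List α)} (hW : PolyTime W)
    (hE : PolyTime E) : PolyTime fun c => tupleAuction r (W c) (E c) :=
  auction (adj := fun c p i => decide (i :: p ∈ E c))
    (mem (snd.snd'.cons snd.fst') (hE.comp fst))
    (hW.flatMap (f := fun _ w => BackdoorKernel.tuples r w) (tuples r snd))
    (hE.flatten.filter (f := fun c v => !decide (v ∈ (W c).flatten))
      (mem snd (hW.flatten.comp fst)).not)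

theorem kernelVertices [DecidableEq α] (r : ℕ) {W E : γ → List (List α)} (hW : PolyTime W)
    (hE : PolyTime E) : PolyTime fun c => kernelVertices r (W c) (E c) :=
  (hW.flatten.append ((tupleAuction r hW hE).map
    (f := fun _ (b : List α × α) => b.2) snd.snd')).dedup

theorem kernelEdges [DecidableEq α] (r : ℕ) {W E : γ → List (List α)} (hW : PolyTime W)
    (hE : PolyTime E) : PolyTime fun c => kernelEdges r (W c) (E c) :=
  (tuples (r + 1) (kernelVertices r hW hE)).filter (f := fun c t => decide (t ∈ E c))
    (mem snd (hE.comp fst))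

theorem unaryName [DecidableEq α] {S : γ → List α} {v : γ → α} (hS : PolyTime S) (hv : PolyTime v) :
    PolyTime fun c => unaryName (S c) (v c) := by
  refine foldr (f := fun c a s => if a = v c then [] else true :: s)
    (ite (snd.snd'.eq (hv.comp fst)) (const []) ((const true).cons snd.fst')) (const []) hS 4
    fun c a s => ?_
  have h₁ := one_le_csize s
  have h₂ := csize_bool_le true
  rw [Polynomial.eval_ofNat]
  split
  · rw [csize_nil]; omega
  · rw [csize_cons]; omega

theorem positiveClauses {f : γ → α → Var} {E : γ → List (List α)}
    (hf : PolyTime fun x : γ × α => f x.1 x.2) (hE : PolyTime E) :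
    PolyTime fun c => positiveClauses (f c) (E c) :=
  hE.map (f := fun c (e : List α) => e.map fun v => (f c v, true))
    (snd.map (f := fun x v => (f x.1 v, true))
    ((hf.comp (fst.fst'.pair snd)).pair (const true)))

theorem of_bool {δ : Type} [TreeCode δ] (f : Bool → δ) : PolyTime f :=
  (cond id (const (f true)) (const (f false))).of_eq fun b => by cases b <;> rfl

theorem edges (r : ℕ) (q : Bool → Bool) {L : γ → List (List Literal)} (hL : PolyTime L) :
    PolyTime fun c => edges r q (L c) :=
  hL.flatMap (f := fun _ C => BackdoorKernel.tuples (r + 1) (selectedVars q C))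
    (tuples (r + 1) ((snd.filter (f := fun _ (l : Literal) => q l.2)
      ((of_bool q).comp snd.snd')).map (f := fun _ (l : Literal) => l.1) snd.fst'))

theorem encodeClause {C : γ → List Literal} (hC : PolyTime C) :
    PolyTime fun c => encodeClause (C c) := by
  refine append (hC.flatMap (f := fun _ l => encodeLiteral l) (cons ?_ ?_)) (const [Sym.endClause])
  · exact (of_bool fun b => if b = true then Sym.pos else Sym.neg).comp snd.snd'
  · exact snd.fst'.map (f := fun _ b => if b = true then Sym.one else Sym.zero)
      ((of_bool fun b => if b = true then Sym.one else Sym.zero).comp snd)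

theorem encode {L : γ → List (List Literal)} (hL : PolyTime L) :
    PolyTime fun c => (L c).flatMap BackdoorKernel.encodeClause :=
  hL.flatMap (f := fun _ C => BackdoorKernel.encodeClause C) (encodeClause snd)

theorem addLiteral {l : γ → Literal} {L : γ → List (List Literal)} (hl : PolyTime l)
    (hL : PolyTime L) : PolyTime fun c => addLiteral (l c) (L c) :=
  (listCases hL (const []) (g := fun c C M => (l c :: C) :: M)
    (((hl.comp fst).cons snd.fst').cons snd.snd')).of_eq fun c => by cases L c <;> rfl

theorem decode {x : γ → List Sym} (hx : PolyTime x) : PolyTime fun c => decode (x c) := by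
  have hs : ∀ s : Sym, PolyTime fun x : γ × (List Bool × List (List Literal)) × Sym =>
      decide (x.2.2 = s) := fun s => snd.snd'.eq (const s)
  -- A sign only moves the digits read so far into a literal, so every symbol adds at most a
  -- constant to the state.
  refine snd' (foldr (f := fun _ s st => decodeStep s st) ?_ (const ([], [])) hx 8 ?_)
  · exact ite (hs _) (((const false).cons snd.fst'.fst').pair snd.fst'.snd')
      (ite (hs _) (((const true).cons snd.fst'.fst').pair snd.fst'.snd')
        (ite (hs _) ((const []).pair (addLiteral (snd.fst'.fst'.pair (const true)) snd.fst'.snd'))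
          (ite (hs _) ((const []).pair
              (addLiteral (snd.fst'.fst'.pair (const false)) snd.fst'.snd'))
            ((const []).pair ((const []).cons snd.fst'.snd')))))
  · rintro c s ⟨v, L⟩
    have h₁ : ∀ b : Bool,
        csize (BackdoorKernel.addLiteral (v, b) L) ≤ csize v + csize L + 5 := by
      intro b
      have := csize_bool_le b
      cases L with
      | nil => rw [BackdoorKernel.addLiteral]; omega
      | cons C M => rw [BackdoorKernel.addLiteral]; simp only [csize_cons, csize_prod]; omega
    have h₂ := h₁ true
    have h₃ := h₁ false
    have h₄ := csize_bool_le true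
    have h₅ := csize_bool_le false
    have h₆ := one_le_csize v
    rw [Polynomial.eval_ofNat]
    simp only [decodeStep]
    split_ifs <;> simp only [csize_prod, csize_cons, csize_nil] <;> omega

theorem wellFormed {x : γ → List Sym} (hx : PolyTime x) : PolyTime fun c => wellFormed (x c) := by
  refine and (hx.decode.encode.eq hx) ?_
  refine all hx.decode
    (f := fun _ (C : List Literal) => C.all fun l => !decide ((l.1, !l.2) ∈ C)) ?_
  exact snd.all (f := fun (x : γ × List Literal) (l : Literal) => !decide ((l.1, !l.2) ∈ x.2))
    (mem (snd.fst'.pair snd.snd'.not) fst.snd').not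

theorem kernelization (r : ℕ) (q : Bool → Bool) : PolyTime (kernelization r q) := by
  have hE : PolyTime fun I : List Sym × ℕ =>
      BackdoorKernel.edges r q (BackdoorKernel.decode I.1) := edges r q (decode fst)
  have hW := packing r (snd (α := List Sym) (β := ℕ)) hE
  refine cond (and (wellFormed fst) (le hW.length ?_)) (pair (encode (positiveClauses ?_ ?_)) snd)
    (const _)
  · exact mul snd (add (mul (const _) snd) (const 1))
  · exact unaryName ((kernelVertices r hW hE).comp fst) snd
  · exact kernelEdges r hW hE

end PolyTime

/-! ### From `PolyTime` to the two kernels -/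

theorem csize_instance_le (x : List Sym) (k : ℕ) :
    csize (x, k) ≤ 8 * (x.length + k) + 3 := by
  have h₁ : csize x ≤ 8 * x.length + 1 := by
    induction x with
    | nil => simp [csize_nil]
    | cons s x ih =>
      have : csize s ≤ 7 := by cases s <;> decide
      rw [csize_cons, List.length_cons]
      omega
  have h₂ : csize k = 2 * k + 1 := by
    induction k with
    | zero => rfl
    | succ k ih =>
      change 1 + csize k + 1 = _
      omega
  rw [csize_prod]
  omega

theorem PolyTime.polyTimeComputable {K : List Sym × ℕ → List Sym × ℕ} (hK : PolyTime K) :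
    PolyTimeComputable K := by
  obtain ⟨p, T, h⟩ := hK
  refine ⟨p, T.comp (8 * .X + 3), fun x k => ?_⟩
  obtain ⟨t, ht, hr⟩ := h (x, k)
  refine ⟨t, ht.trans ?_, hr⟩
  simpa using eval_mono_right T (csize_instance_le x k)

theorem hasPolyKernelWithVars_signBounded {r : ℕ} (hr : r = 1 ∨ r = 2) {q : Bool → Bool}
    (hq : q true = true) {N : ℕ → ℕ} (hN : ∀ k, max (r + 1) (vertexBound r k) ≤ N k) :
    HasPolyKernelWithVars (signBounded q r) N := by
  refine ⟨kernelization r q, ⟨(PolyTime.kernelization r q).polyTimeComputable,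
    kernelization_correct hr hq, exists_polynomial_kernelization_length r q⟩, fun x k => ?_⟩
  obtain ⟨F, hF, h⟩ := kernelization_vars r q (x, k)
  exact ⟨F, hF, h.trans (hN k)⟩

end BackdoorKernel

theorem mainTheorem12 :
    (∃ c : ℕ, BackdoorKernel.HasPolyKernelWithVars BackdoorKernel.Horn
      (fun k => c * (k + 1))) ∧
    (∃ c : ℕ, BackdoorKernel.HasPolyKernelWithVars (BackdoorKernel.CNF 2)
      (fun k => c * (k + 1) ^ 2)) := by
  -- The values come from `vertexBound`: it is k(2 + 2) for r = 1 and k(k + 1)(3 + 9) for r = 2.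
  refine ⟨⟨4, ?_⟩, ⟨12, ?_⟩⟩
  · rw [BackdoorKernel.horn_eq]
    refine BackdoorKernel.hasPolyKernelWithVars_signBounded (.inl rfl) rfl fun k => max_le ?_ ?_
    · omega
    · simp only [BackdoorKernel.vertexBound, BackdoorKernel.packingBound]
      omega
  · rw [BackdoorKernel.cnf_eq]
    refine BackdoorKernel.hasPolyKernelWithVars_signBounded (.inr rfl) rfl fun k => max_le ?_ ?_
    · have := Nat.one_le_pow 2 (k + 1) (Nat.succ_pos k)
      omega
    · simp only [BackdoorKernel.vertexBound, BackdoorKernel.packingBound]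
      nlinarith
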